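/- Let $A=(a_{ij})$ be a real $n\times d$ matrix of rank $d$ without zero rows, let $w\in\mathbb R^n$, and let $\mathbb V$ be the arrangement of the $n$ affine hyperplanes $\{s\in\mathbb R^d:\sum_j a_{ij}s_j+w_i=0\}$. Put $\ell_i(z)=\sum_j a_{ij}z_j+w_i$ for $z\in\mathbb C^d$, $M(\mathbb V)=\mathbb C^d\setminus\bigcup_i\{\ell_i=0\}$, and $$\phi=\sum_{i=1}^n\bigl(|\ell_i|^2+|\ell_i|^{-2}\bigr)\colon M(\mathbb V)\to\mathbb R .$$ Let $\omega$ be the pullback of the standard form $4\sum_k dx_k\wedge dy_k$ on $\mathbb C^{2n}$ under the embedding $z\mapsto(\ell_i(z),1/\ell_i(z))_{i}$, let $J$ be the complex structure of $\mathbb C^d$, put $d^{\mathbb C}\psi=d\psi\circ J$ and $\omega_\psi=-dd^{\mathbb C}\psi$, and let $\nabla\psi$ be the gradient of $\psi$ for the metric $\omega(\cdot,J\cdot)$ (respectively $\omega_\psi(\cdot,J\cdot)$ when the form is $\omega_\psi$). A *Liouville manifold* is a triple $(X,\omega,Z)$ in which $\omega$ is a symplectic form on $X$ and $Z$ is a complete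 smooth vector field with $d(\iota_Z\omega)=\omega$, such that there is a compact codimension-$0$ submanifold $X_0\subseteq X$ with smooth boundary along which $Z$ points strictly outward, and $Z$ has no zeros outside $X_0$. A smooth function $\phi$ on $X$ is *exhausting* if all its sublevel sets $\{\phi\le c\}$ are compact, and *Lyapunov* for $Z$ if $d\phi(Z)\ge\delta(|Z|^2+|d\phi|^2)$ for some positive continuous function $\delta$. The tuple $(X,\omega,Z,\phi)$ is a *Weinstein manifold* if $(X,\omega,Z)$ is a Liouville manifold and $\phi$ is an exhausting Morse function that is Lyapunov for $Z$. Then: 1. The critical points of $\phi$ lie in a compact subset of $M(\mathbb V)$. 2. $\omega=-dd^{\mathbb C}\phi$ on $M(\mathbb V)$, the triple $(M(\mathbb V),\omega,\nabla\phi)$ is a Liouville manifold, and $\phi$ is smooth, exhausting and Lyapunov for $\nabla\phi$. In particular, if $\phi$ is Morse, then $(M(\mathbb V),\omega,\nabla\phi,\phi)$ is a Weinstein manifold with finitely many critical points. 3. In general $(M(\mathbb V),\omega,\nabla\phi,\phi)$ is a Weinstein manifold of finite type up to an arbitrarily small compactly supported perturbation of the potential: for all $m\in\mathbb N$ and $\varepsilon>0$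 there is a smooth function $h\colon\mathbb C^d\to\mathbb R$ with compact support contained in $M(\mathbb V)$, all of whose derivatives of order at most $m$ are smaller than $\varepsilon$ in norm, such that, with $\phi_t=\phi+th$: - for all $t\in[0,1]$, $(M(\mathbb V),\omega_{\phi_t},\nabla\phi_t)$ is a Liouville manifold for which $\phi_t$ is a smooth exhausting Lyapunov function, and the critical points of all the $\phi_t$, $t\in[0,1]$, lie in one compact subset of $M(\mathbb V)$; - $\phi_1$ is Morse with finitely many critical points, so that $(M(\mathbb V),\omega_{\phi_1},\nabla\phi_1,\phi_1)$ is a Weinstein manifold of finite type. -/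

import Mathlib

open scoped ContDiff

noncomputable section

/-! ### Weinstein structures on open subsets of a real normed space -/

section Weinstein

variable {E : Type*} [NormedAddCommGroup E] [NormedSpace ℝ E]

/-- The critical points in `U` of a function. -/
def critSet (U : Set E) (φ : E → ℝ) : Set E :=
  {z | z ∈ U ∧ fderiv ℝ φ z = 0}

/-- `Ω` is a symplectic form on `U`: smooth, closed and nondegenerate. -/
structure IsSymplecticFormOn (U : Set E) (Ω : E → E [⋀^Fin 2]→L[ℝ] ℝ) : Prop where
  smooth : ContDiffOn ℝ ∞ Ω U
  closed : ∀ z ∈ U, extDeriv Ω z = 0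
  nondegenerate : ∀ z ∈ U, ∀ u : E, (∀ v : E, Ω z ![u, v] = 0) → u = 0

/-- The 1-form `Ω(Z, ·)`. -/
def interiorProd (Z : E → E) (Ω : E → E [⋀^Fin 2]→L[ℝ] ℝ) (z : E) : E [⋀^Fin 1]→L[ℝ] ℝ :=
  (Ω z).curryLeft (Z z)

/-- Every integral curve of `Z` in `U` exists, inside `U`, for all times. -/
def IsCompleteOn (U : Set E) (Z : E → E) : Prop :=
  ∀ p ∈ U, ∃ γ : ℝ → E, γ 0 = p ∧ ∀ t : ℝ, γ t ∈ U ∧ HasDerivAt γ (Z (γ t)) t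

/-- `X₀ ⊆ U` is a compact codimension-0 submanifold with smooth boundary such that `Z` points
strictly outward along the boundary: near each boundary point, `X₀ = {r ≤ 0}` for a smooth
function `r` with `dr(Z) > 0` (in particular `dr ≠ 0`) at that point. -/
structure IsOutwardDomain (U : Set E) (Z : E → E) (X₀ : Set E) : Prop where
  compact : IsCompact X₀
  subset : X₀ ⊆ U
  boundary : ∀ p ∈ frontier X₀, ∃ (N : Set E) (r : E → ℝ), IsOpen N ∧ p ∈ N ∧
    ContDiffOn ℝ ∞ r N ∧ X₀ ∩ N = {z | z ∈ N ∧ r z ≤ 0} ∧ 0 < fderiv ℝ r p (Z p)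

/-- `(U, Ω, Z)` is a Liouville manifold. The condition `liouville` says that the 1-form dual to
`Z` is a primitive of `Ω`, that is, `L_Z Ω = Ω`. -/
structure IsLiouvilleManifold (U : Set E) (Ω : E → E [⋀^Fin 2]→L[ℝ] ℝ) (Z : E → E) : Prop where
  isOpen : IsOpen U
  symplectic : IsSymplecticFormOn U Ω
  smooth : ContDiffOn ℝ ∞ Z U
  complete : IsCompleteOn U Z
  liouville : ∀ z ∈ U, extDeriv (interiorProd Z Ω) z = Ω z
  domain : ∃ X₀ : Set E, IsOutwardDomain U Z X₀ ∧ ∀ z ∈ U \ X₀, Z z ≠ 0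

/-- `φ` is exhausting on `U`: every sublevel set is compact (equivalently, for continuous `φ`,
`φ` is proper and bounded below). -/
def IsExhaustingOn (U : Set E) (φ : E → ℝ) : Prop :=
  ∀ c : ℝ, IsCompact {z | z ∈ U ∧ φ z ≤ c}

/-- `φ` is a Lyapunov function for `Z` on `U`: `dφ(Z) ≥ δ (|Z|² + |dφ|²)` for a positive
continuous function `δ`. (As `δ` may vary, the choice of Riemannian metric is immaterial.) -/
def IsLyapunovOn (U : Set E) (Z : E → E) (φ : E → ℝ) : Prop :=
  ∃ δ : E → ℝ, ContinuousOn δ U ∧ ∀ z ∈ U, 0 < δ z ∧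
    δ z * (‖Z z‖ ^ 2 + ‖fderiv ℝ φ z‖ ^ 2) ≤ fderiv ℝ φ z (Z z)

/-- All critical points of `φ` in `U` are nondegenerate. -/
def IsMorseOn (U : Set E) (φ : E → ℝ) : Prop :=
  ∀ z ∈ critSet U φ, ∀ u : E, (∀ v : E, fderiv ℝ (fderiv ℝ φ) z u v = 0) → u = 0

/-- `(U, Ω, Z)` is a Liouville manifold with a smooth exhausting Lyapunov function `φ`
(a Weinstein manifold, except that `φ` need not be Morse). -/
structure IsPreWeinsteinManifold (U : Set E) (Ω : E → E [⋀^Fin 2]→L[ℝ] ℝ) (Z : E → E)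
    (φ : E → ℝ) : Prop where
  liouvilleManifold : IsLiouvilleManifold U Ω Z
  smooth_fun : ContDiffOn ℝ ∞ φ U
  exhausting : IsExhaustingOn U φ
  lyapunov : IsLyapunovOn U Z φ

/-- `(U, Ω, Z, φ)` is a Weinstein manifold: `φ` is moreover a Morse function. -/
structure IsWeinsteinManifold (U : Set E) (Ω : E → E [⋀^Fin 2]→L[ℝ] ℝ) (Z : E → E)
    (φ : E → ℝ) : Prop extends IsPreWeinsteinManifold U Ω Z φ where
  morse : IsMorseOn U φ

end Weinstein

/-! ### Potentials on open subsets of a complex normed space -/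

section Kahler

variable {E : Type*} [NormedAddCommGroup E] [NormedSpace ℂ E]
  [NormedSpace ℝ E] [IsScalarTower ℝ ℂ E]

/-- The 1-form `d^ℂ ψ = dψ ∘ J`, where `J` is multiplication by `√-1`. -/
def dC (ψ : E → ℝ) (z : E) : E [⋀^Fin 1]→L[ℝ] ℝ :=
  (extDeriv (fun x => ContinuousAlternatingMap.constOfIsEmpty ℝ E (Fin 0) (ψ x))
    z).compContinuousLinearMap (Complex.I • ContinuousLinearMap.id ℝ E)

/-- The 2-form `-d d^ℂ ψ`. -/
def negDDC (ψ : E → ℝ) (z : E) : E [⋀^Fin 2]→L[ℝ] ℝ :=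
  -extDeriv (dC ψ) z

/-- The gradient of `ψ` with respect to `g(u, v) = Ω(u, J v)`: the vector `∇ψ` with
`Ω(∇ψ, J v) = dψ(v)` for all `v`, which is unique wherever `Ω` is nondegenerate. -/
def kahlerGradient (Ω : E → E [⋀^Fin 2]→L[ℝ] ℝ) (ψ : E → ℝ) (z : E) : E :=
  Classical.epsilon fun u : E => ∀ v : E, Ω z ![u, Complex.I • v] = fderiv ℝ ψ z v

end Kahler

/-! ### Hyperplane arrangements and their complexified complements -/

/-- An arrangement of `n` hyperplanes `∑ⱼ aᵢⱼ sⱼ + wᵢ = 0` in `ℝᵈ`. It is the arrangement of the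
pair `(V, η)`, where the `d`-dimensional subspace `V ⊆ ℝⁿ` is the image of the injective linear
map with matrix `(aᵢⱼ)`, and `η ∈ ℝⁿ / V` is the class of `w`. -/
structure HyperplaneArrangement (d n : ℕ) where
  a : Matrix (Fin n) (Fin d) ℝ
  w : Fin n → ℝ
  injective : Function.Injective a.mulVec
  normal_ne_zero : ∀ i, a i ≠ 0

namespace HyperplaneArrangement

variable {d n : ℕ} (𝕍 : HyperplaneArrangement d n)

/-- The complexified affine form `ℓᵢ(z) = ∑ⱼ aᵢⱼ zⱼ + wᵢ`. -/
def ell (i : Fin n) (z : Fin d → ℂ) : ℂ :=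
  ∑ j, (𝕍.a i j : ℂ) * z j + (𝕍.w i : ℂ)

/-- The complexified hyperplane `Hᵢ ⊆ ℂᵈ`. -/
def hyperplane (i : Fin n) : Set (Fin d → ℂ) :=
  {z | 𝕍.ell i z = 0}

/-- The complement `M(𝕍) = ℂᵈ \ ⋃ᵢ Hᵢ`. -/
def complement : Set (Fin d → ℂ) :=
  (⋃ i, 𝕍.hyperplane i)ᶜ

/-- The embedding `z ↦ (ℓᵢ(z), 1 / ℓᵢ(z))ᵢ` of `M(𝕍)` into `ℂ²ⁿ`. -/
def embed (z : Fin d → ℂ) : Fin n ⊕ Fin n → ℂ :=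
  Sum.elim (fun i => 𝕍.ell i z) (fun i => (𝕍.ell i z)⁻¹)

/-- The potential `φ = ∑ᵢ (|ℓᵢ|² + |ℓᵢ|⁻²)`. -/
def potential (z : Fin d → ℂ) : ℝ :=
  ∑ i, (‖𝕍.ell i z‖ ^ 2 + (‖𝕍.ell i z‖ ^ 2)⁻¹)

end HyperplaneArrangement

/-- The standard symplectic form `2√-1 ∑ⱼ dzⱼ ∧ dz̄ⱼ = 4 ∑ⱼ dxⱼ ∧ dyⱼ`. -/
def stdSymplectic (ι : Type*) [Fintype ι] : (ι → ℂ) [⋀^Fin 2]→L[ℝ] ℝ where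
  toFun u := 4 * ∑ j, ((u 0 j).re * (u 1 j).im - (u 0 j).im * (u 1 j).re)
  map_update_add' u i x y := by
    rw [← mul_add, ← Finset.sum_add_distrib]
    congr 1
    refine Finset.sum_congr rfl fun j _ => ?_
    fin_cases i <;> simp <;> ring
  map_update_smul' u i c x := by
    simp only [smul_eq_mul, Finset.mul_sum]
    refine Finset.sum_congr rfl fun j _ => ?_
    fin_cases i <;> simp <;> ring
  cont := by
    change Continuous fun u : Fin 2 → ι → ℂ =>
      4 * ∑ j, ((u 0 j).re * (u 1 j).im - (u 0 j).im * (u 1 j).re)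
    fun_prop
  map_eq_zero_of_eq' u i j h hij := by
    have h01 : u 0 = u 1 := by
      fin_cases i <;> fin_cases j <;> simp_all
    simp only [h01]
    simp [mul_comm]

namespace HyperplaneArrangement

variable {d n : ℕ} (𝕍 : HyperplaneArrangement d n)

/-- The symplectic form `Ω` on `M(𝕍)`: the pullback of the standard symplectic form. -/
def omega (z : Fin d → ℂ) : (Fin d → ℂ) [⋀^Fin 2]→L[ℝ] ℝ :=
  (stdSymplectic (Fin n ⊕ Fin n)).compContinuousLinearMap (fderiv ℝ 𝕍.embed z)

end HyperplaneArrangement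

end

/-! The potential is `φ = ∑ⱼ |fⱼ|²`, where the `fⱼ` are the holomorphic functions `ℓᵢ` and `1/ℓᵢ`.
Everything is read off from the Levi form `L(u, v) = D²ψ(u, v) + D²ψ(Ju, Jv) = ω_ψ(u, Jv)`. For
`|f|²` it equals `4⟨df u, df v⟩`, so `ω = -dd^ℂφ`, and `L` is positive definite because the matrix
has full rank (`leviForm_norm_sq`, `omega_eq`, `isStrictlyPSHOn_potential`). The gradient `Z` is the
solution of `L(Z, ·) = dψ`. Hence `ι_Z ω_ψ = -d^ℂψ`, which gives the Liouville condition, and `dψ(Z)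
= L(Z, Z)` gives the Lyapunov inequality by Cauchy–Schwarz.

Completeness: `dφ(Z)` equals both `∑ 2⟨fⱼ, dfⱼ Z⟩` and `∑ 4|dfⱼ Z|²`, so the arithmetic-geometric
mean inequality yields `0 ≤ dφ(Z) ≤ φ` (`fderiv_potential_grad_le`). Thus `φ` grows at most
exponentially along the flow and, being exhausting, confines it to compact sets in bounded time
(`isCompleteOn_of_growth`).

Compactness of the critical set: `dφ_z(v) = ∑ 2(1 - |ℓᵢ|⁻⁴)⟨ℓᵢ, aᵢ v⟩`, with `aᵢ` the linear part of
`ℓᵢ`, is tested on suitable vectors `v`. Far out, `v` is `z` moved into the common kernel of the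
`aᵢ` with `|ℓᵢ(z)| ≤ 1`; the singular terms disappear and the others behave like `2|ℓᵢ|²`
(`exists_critSet_bound`). Near a point `p` of a hyperplane, `v = z - p` makes the terms `-2|ℓᵢ|⁻²`
dominate (`eventually_notMem_critSet`).

Perturbation: `h` is a small linear form, cut off near the critical set. By Sard's theorem the form
can be chosen so that the critical points become nondegenerate, while smallness preserves positivity
of the Levi form and prevents critical points where the cutoff takes effect
(`exists_morse_perturbation`). -/

open scoped ContDiff Topology
open Set Filter

/-! ### The Levi form and the closed two-form `-dd^ℂψ`. -/

section LeviForm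

variable {E : Type*} [NormedAddCommGroup E] [NormedSpace ℂ E]
  [NormedSpace ℝ E] [IsScalarTower ℝ ℂ E]

variable (E) in
/-- Multiplication by `√-1` as a real continuous linear map. -/
noncomputable def mulI : E →L[ℝ] E := Complex.I • ContinuousLinearMap.id ℝ E

lemma I_smul_I_smul {E : Type*} [AddCommGroup E] [Module ℂ E] (v : E) : Complex.I • Complex.I • v = -v := by
  rw [smul_smul, Complex.I_mul_I, neg_one_smul]

/-- The symmetric bilinear form `D²ψ(u, v) + D²ψ(J u, J v)`. -/
noncomputable def leviForm (ψ : E → ℝ) (z : E) : E →L[ℝ] E →L[ℝ] ℝ :=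
  fderiv ℝ (fderiv ℝ ψ) z +
    ((ContinuousLinearMap.compL ℝ E E ℝ).flip (mulI E)) ∘L fderiv ℝ (fderiv ℝ ψ) z ∘L mulI E

lemma leviForm_apply (ψ : E → ℝ) (z u v : E) :
    leviForm ψ z u v = fderiv ℝ (fderiv ℝ ψ) z u v +
      fderiv ℝ (fderiv ℝ ψ) z (Complex.I • u) (Complex.I • v) := rfl

lemma leviForm_symm {ψ : E → ℝ} {z : E} (h : ContDiffAt ℝ ∞ ψ z) (u v : E) :
    leviForm ψ z u v = leviForm ψ z v u := by
  have hs : IsSymmSndFDerivAt ℝ ψ z := h.isSymmSndFDerivAt (by simp; norm_cast)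
  rw [leviForm_apply, leviForm_apply, hs.eq u v, hs.eq (Complex.I • u)]

lemma ContDiffOn.fderiv_infty {E F : Type*} [NormedAddCommGroup E] [NormedSpace ℝ E]
    [NormedAddCommGroup F] [NormedSpace ℝ F] {U : Set E} (hU : IsOpen U) {f : E → F} (h : ContDiffOn ℝ ∞ f U) :
    ContDiffOn ℝ ∞ (fderiv ℝ f) U :=
  h.fderiv_of_isOpen hU (by simp)

lemma contDiffOn_leviForm {U : Set E} (hU : IsOpen U) {ψ : E → ℝ} (h : ContDiffOn ℝ ∞ ψ U) :
    ContDiffOn ℝ ∞ (leviForm ψ) U := by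
  have h2 := ContDiffOn.fderiv_infty hU (ContDiffOn.fderiv_infty hU h)
  exact h2.add (contDiffOn_const.clm_comp (h2.clm_comp contDiffOn_const))

lemma leviForm_congr {ψ₁ ψ₂ : E → ℝ} {z : E} (h : ψ₁ =ᶠ[𝓝 z] ψ₂) :
    leviForm ψ₁ z = leviForm ψ₂ z := by
  simp only [leviForm, h.fderiv.fderiv_eq]

/-- The linear map sending a linear form `l` to the alternating `1`-form `l ∘ J`. -/
noncomputable def oneFormI : (E →L[ℝ] ℝ) →L[ℝ] (E [⋀^Fin 1]→L[ℝ] ℝ) :=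
  (ContinuousAlternatingMap.compContinuousLinearMapCLM (mulI E)) ∘L
    ((ContinuousAlternatingMap.ofSubsingletonLIE (𝕜 := ℝ) (E := E) (F := ℝ) (0 : Fin 1)).toContinuousLinearEquiv :
      (E →L[ℝ] ℝ) →L[ℝ] (E [⋀^Fin 1]→L[ℝ] ℝ))

lemma oneFormI_apply (l : E →L[ℝ] ℝ) (v : Fin 1 → E) :
    oneFormI l v = l (Complex.I • v 0) := rfl

lemma dC_eq (ψ : E → ℝ) : dC ψ = fun z => oneFormI (fderiv ℝ ψ z) := by
  funext z
  simp only [dC, extDeriv_constOfIsEmpty]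
  rfl

lemma contDiffOn_dC {U : Set E} (hU : IsOpen U) {ψ : E → ℝ} (h : ContDiffOn ℝ ∞ ψ U) :
    ContDiffOn ℝ ∞ (dC ψ) U := by
  rw [dC_eq]
  exact oneFormI.contDiff.comp_contDiffOn (ContDiffOn.fderiv_infty hU h)

lemma contDiffOn_negDDC {U : Set E} (hU : IsOpen U) {ψ : E → ℝ} (h : ContDiffOn ℝ ∞ ψ U) :
    ContDiffOn ℝ ∞ (negDDC ψ) U := by
  have h1 := ContDiffOn.fderiv_infty hU (contDiffOn_dC hU h)
  exact ((ContinuousAlternatingMap.alternatizeUncurryFinCLM ℝ E ℝ).contDiff.comp_contDiffOn h1).neg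

lemma negDDC_apply {ψ : E → ℝ} {z : E} (h : ContDiffAt ℝ ∞ ψ z) (v : Fin 2 → E) :
    negDDC ψ z v = fderiv ℝ (fderiv ℝ ψ) z (v 1) (Complex.I • v 0) -
      fderiv ℝ (fderiv ℝ ψ) z (v 0) (Complex.I • v 1) := by
  have hd : DifferentiableAt ℝ (fderiv ℝ ψ) z :=
    (h.fderiv_right (m := 1) (by norm_cast)).differentiableAt (by simp)
  have h1 : fderiv ℝ (dC ψ) z = oneFormI ∘L fderiv ℝ (fderiv ℝ ψ) z := by
    rw [dC_eq]
    exact (oneFormI.hasFDerivAt.comp z hd.hasFDerivAt).fderiv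
  rw [negDDC, ContinuousAlternatingMap.neg_apply, extDeriv,
    ContinuousAlternatingMap.alternatizeUncurryFin_apply, h1]
  simp [Fin.sum_univ_two, oneFormI_apply, Fin.removeNth, sub_eq_add_neg]

/-- Follows from `J² = -1` and the symmetry of the Hessian. It reduces nondegeneracy and the
gradient equation to linear algebra of a symmetric form. -/
lemma negDDC_apply_I {ψ : E → ℝ} {z : E} (h : ContDiffAt ℝ ∞ ψ z) (u v : E) :
    negDDC ψ z ![u, Complex.I • v] = leviForm ψ z u v := by
  have hs : IsSymmSndFDerivAt ℝ ψ z := h.isSymmSndFDerivAt (by simp; norm_cast)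
  rw [negDDC_apply h]
  simp only [Matrix.cons_val_zero, Matrix.cons_val_one, I_smul_I_smul, map_neg, leviForm_apply]
  rw [hs.eq (Complex.I • v)]
  ring

lemma extDeriv_negDDC {U : Set E} (hU : IsOpen U) {ψ : E → ℝ} (h : ContDiffOn ℝ ∞ ψ U) {z : E}
    (hz : z ∈ U) : extDeriv (negDDC ψ) z = 0 := by
  have h1 : negDDC ψ = (-1 : ℝ) • extDeriv (dC ψ) := by
    funext x; simp [negDDC]
  rw [h1, extDeriv_smul, extDeriv_extDeriv_apply
    ((contDiffOn_dC hU h).contDiffAt (hU.mem_nhds hz)) (by simp; norm_cast), smul_zero]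

end LeviForm

/-! ### Gradients of strictly plurisubharmonic functions. -/

section Gradient

variable {E : Type*} [NormedAddCommGroup E] [NormedSpace ℂ E]
  [NormedSpace ℝ E] [IsScalarTower ℝ ℂ E]

/-- The gradient field of `ψ`, defined through the inverse of the Levi form. -/
noncomputable def leviGrad (ψ : E → ℝ) (z : E) : E :=
  (leviForm ψ z).inverse (fderiv ℝ ψ z)

/-- `ψ` is smooth on the open set `U`, and `-dd^ℂψ` tames the complex structure there. -/
structure IsStrictlyPSHOn (U : Set E) (ψ : E → ℝ) : Prop where
  isOpen : IsOpen U
  smooth : ContDiffOn ℝ ∞ ψ U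
  pos : ∀ z ∈ U, ∀ u : E, u ≠ 0 → 0 < leviForm ψ z u u

namespace IsStrictlyPSHOn

variable {U : Set E} {ψ : E → ℝ} (H : IsStrictlyPSHOn U ψ) {z : E}

lemma contDiffAt (H : IsStrictlyPSHOn U ψ) (hz : z ∈ U) : ContDiffAt ℝ ∞ ψ z :=
  H.smooth.contDiffAt (H.isOpen.mem_nhds hz)

lemma isSymplecticFormOn (H : IsStrictlyPSHOn U ψ) {Ω : E → E [⋀^Fin 2]→L[ℝ] ℝ}
    (hΩ : ∀ z ∈ U, Ω z = negDDC ψ z) : IsSymplecticFormOn U Ω where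
  smooth := (contDiffOn_negDDC H.isOpen H.smooth).congr hΩ
  closed z hz := by
    have : Ω =ᶠ[𝓝 z] negDDC ψ := by
      filter_upwards [H.isOpen.mem_nhds hz] with x hx using hΩ x hx
    rw [this.extDeriv_eq, extDeriv_negDDC H.isOpen H.smooth hz]
  nondegenerate z hz u hu := by
    by_contra hne
    have h1 := hu (Complex.I • u)
    rw [hΩ z hz, negDDC_apply_I (H.contDiffAt hz)] at h1
    exact (H.pos z hz u hne).ne' h1

variable [FiniteDimensional ℝ E]

/-- The Levi form at a point of `U` as an isomorphism of `E` with its dual. -/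
lemma exists_equiv (H : IsStrictlyPSHOn U ψ) (hz : z ∈ U) :
    ∃ e : E ≃L[ℝ] (E →L[ℝ] ℝ), (e : E →L[ℝ] E →L[ℝ] ℝ) = leviForm ψ z := by
  have hinj : Function.Injective (leviForm ψ z : E →ₗ[ℝ] E →L[ℝ] ℝ) := by
    rw [← LinearMap.ker_eq_bot, LinearMap.ker_eq_bot']
    intro u hu
    by_contra hne
    have := H.pos z hz u hne
    have h0 : leviForm ψ z u = 0 := hu
    simp [h0] at this
  have hfin : Module.finrank ℝ E = Module.finrank ℝ (E →L[ℝ] ℝ) := by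
    rw [← (LinearMap.toContinuousLinearMap (𝕜 := ℝ) (E := E) (F' := ℝ)).finrank_eq]
    exact (Subspace.dual_finrank_eq (K := ℝ) (V := E)).symm
  refine ⟨(LinearEquiv.ofInjectiveOfFinrankEq _ hinj hfin).toContinuousLinearEquiv, ?_⟩
  ext u v
  rfl

lemma contDiffOn_inverse (H : IsStrictlyPSHOn U ψ) :
    ContDiffOn ℝ ∞ (fun z => (leviForm ψ z).inverse) U := by
  intro z hz
  obtain ⟨e, he⟩ := H.exists_equiv hz
  have h1 := contDiffAt_map_inverse (n := ∞) e
  rw [he] at h1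
  exact (h1.comp z ((contDiffOn_leviForm H.isOpen H.smooth).contDiffAt
    (H.isOpen.mem_nhds hz))).contDiffWithinAt

lemma contDiffOn_grad (H : IsStrictlyPSHOn U ψ) : ContDiffOn ℝ ∞ (leviGrad ψ) U :=
  H.contDiffOn_inverse.clm_apply (ContDiffOn.fderiv_infty H.isOpen H.smooth)

lemma leviForm_grad (H : IsStrictlyPSHOn U ψ) (hz : z ∈ U) :
    leviForm ψ z (leviGrad ψ z) = fderiv ℝ ψ z := by
  obtain ⟨e, he⟩ := H.exists_equiv hz
  rw [leviGrad, ← he, ContinuousLinearMap.inverse_equiv]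
  simp

lemma eq_grad (H : IsStrictlyPSHOn U ψ) (hz : z ∈ U) {u : E}
    (hu : leviForm ψ z u = fderiv ℝ ψ z) : u = leviGrad ψ z := by
  obtain ⟨e, he⟩ := H.exists_equiv hz
  apply e.injective
  have h1 := H.leviForm_grad hz
  rw [← he] at h1 hu
  exact hu.trans h1.symm

/-- The arbitrary choice in `kahlerGradient` is pinned down by invertibility of the Levi form; the
right-hand side depends visibly smoothly on the point. -/
lemma kahlerGradient_eq (H : IsStrictlyPSHOn U ψ) {Ω : E → E [⋀^Fin 2]→L[ℝ] ℝ}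
    (hΩ : ∀ z ∈ U, Ω z = negDDC ψ z) (hz : z ∈ U) : kahlerGradient Ω ψ z = leviGrad ψ z := by
  have key : ∀ u v, Ω z ![u, Complex.I • v] = leviForm ψ z u v := fun u v => by
    rw [hΩ z hz, negDDC_apply_I (H.contDiffAt hz)]
  have hex : ∃ u : E, ∀ v : E, Ω z ![u, Complex.I • v] = fderiv ℝ ψ z v :=
    ⟨leviGrad ψ z, fun v => by rw [key, H.leviForm_grad hz]⟩
  have hs := Classical.epsilon_spec hex
  exact H.eq_grad hz (ContinuousLinearMap.ext fun v => (key _ v).symm.trans (hs v))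

lemma fderiv_grad_nonneg (H : IsStrictlyPSHOn U ψ) (hz : z ∈ U) :
    0 ≤ fderiv ℝ ψ z (leviGrad ψ z) := by
  rw [← H.leviForm_grad hz]
  by_cases h : leviGrad ψ z = 0
  · simp [h]
  · exact (H.pos z hz _ h).le

lemma fderiv_grad_pos (H : IsStrictlyPSHOn U ψ) (hz : z ∈ U) (hd : fderiv ℝ ψ z ≠ 0) :
    0 < fderiv ℝ ψ z (leviGrad ψ z) := by
  rw [← H.leviForm_grad hz]
  refine H.pos z hz _ fun h => hd ?_
  rw [← H.leviForm_grad hz, h, map_zero]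

/-- Cauchy–Schwarz for the Levi form `L`: since `dψ = L(Z, ·)`, one has `dψ(v)² ≤ L(Z, Z) L(v, v)`,
where `L(Z, Z) = dψ(Z)` and `L(v, v) ≤ ‖L‖ ‖v‖²`. -/
lemma sq_fderiv_le (H : IsStrictlyPSHOn U ψ) (hz : z ∈ U) :
    ‖fderiv ℝ ψ z‖ ^ 2 ≤ ‖leviForm ψ z‖ * fderiv ℝ ψ z (leviGrad ψ z) := by
  have hnn : ∀ u, 0 ≤ leviForm ψ z u u := fun u => by
    by_cases h : u = 0
    · simp [h]
    · exact (H.pos z hz u h).le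
  set Z := leviGrad ψ z
  have hZ : leviForm ψ z Z = fderiv ℝ ψ z := H.leviForm_grad hz
  have hr : 0 ≤ ‖leviForm ψ z‖ * fderiv ℝ ψ z Z :=
    by
    have := H.fderiv_grad_nonneg hz
    positivity
  have hle : ‖fderiv ℝ ψ z‖ ≤ √(‖leviForm ψ z‖ * fderiv ℝ ψ z Z) := by
    refine ContinuousLinearMap.opNorm_le_bound _ (Real.sqrt_nonneg _) fun v => ?_
    have hcs : (fderiv ℝ ψ z v) ^ 2 ≤ fderiv ℝ ψ z Z * leviForm ψ z v v := by
      rw [← hZ]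
      have hq : ∀ t : ℝ, 0 ≤ leviForm ψ z v v * (t * t) + 2 * leviForm ψ z Z v * t
          + leviForm ψ z Z Z := fun t => by
        have h1 := hnn (Z + t • v)
        have h2 := leviForm_symm (H.contDiffAt hz) v Z
        simp only [map_add, map_smul, add_apply, smul_apply,
          smul_eq_mul] at h1
        rw [h2] at h1
        linarith
      have := discrim_le_zero hq
      rw [discrim] at this
      nlinarith
    have hb : leviForm ψ z v v ≤ ‖leviForm ψ z‖ * ‖v‖ * ‖v‖ :=
      (Real.le_norm_self _).trans ((leviForm ψ z).le_opNorm₂ v v)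
    rw [← Real.sqrt_sq (norm_nonneg v), ← Real.sqrt_mul hr, Real.norm_eq_abs]
    refine Real.abs_le_sqrt (hcs.trans ?_)
    calc _ ≤ fderiv ℝ ψ z Z * (‖leviForm ψ z‖ * ‖v‖ * ‖v‖) :=
          mul_le_mul_of_nonneg_left hb (H.fderiv_grad_nonneg hz)
      _ = _ := by ring
  calc _ ≤ √(‖leviForm ψ z‖ * fderiv ℝ ψ z Z) ^ 2 := by gcongr
    _ = _ := Real.sq_sqrt hr

/-- `|Z|` is controlled by `‖L⁻¹‖ |dψ|`, and `|dψ|²` by `‖L‖ dψ(Z)`. The summand `1` added to `‖L‖`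
keeps the denominator of `δ` positive. -/
lemma isLyapunovOn_grad (H : IsStrictlyPSHOn U ψ) : IsLyapunovOn U (leviGrad ψ) ψ := by
  have hc1 : ContinuousOn (fun z => (leviForm ψ z).inverse) U := H.contDiffOn_inverse.continuousOn
  have hc2 : ContinuousOn (leviForm ψ) U := (contDiffOn_leviForm H.isOpen H.smooth).continuousOn
  have hpos : ∀ z, 0 < (1 + ‖(leviForm ψ z).inverse‖ ^ 2) * (‖leviForm ψ z‖ + 1) :=
    fun z => by positivity
  refine ⟨fun z => ((1 + ‖(leviForm ψ z).inverse‖ ^ 2) * (‖leviForm ψ z‖ + 1))⁻¹,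
    ContinuousOn.inv₀ ?_ fun z _ => (hpos z).ne', fun z hz => ⟨inv_pos.2 (hpos z), ?_⟩⟩
  · exact (continuousOn_const.add ((ContinuousOn.norm (E := (E →L[ℝ] ℝ) →L[ℝ] E) hc1).pow 2)).mul ((ContinuousOn.norm (E := E →L[ℝ] E →L[ℝ] ℝ) hc2).add continuousOn_const)
  · rw [inv_mul_le_iff₀ (hpos z)]
    have h1 : ‖leviGrad ψ z‖ ≤ ‖(leviForm ψ z).inverse‖ * ‖fderiv ℝ ψ z‖ :=
      ContinuousLinearMap.le_opNorm _ _
    have h2 := H.sq_fderiv_le hz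
    have h3 := H.fderiv_grad_nonneg hz
    calc ‖leviGrad ψ z‖ ^ 2 + ‖fderiv ℝ ψ z‖ ^ 2
        ≤ (‖(leviForm ψ z).inverse‖ * ‖fderiv ℝ ψ z‖) ^ 2 + ‖fderiv ℝ ψ z‖ ^ 2 := by gcongr
      _ = (1 + ‖(leviForm ψ z).inverse‖ ^ 2) * ‖fderiv ℝ ψ z‖ ^ 2 := by ring
      _ ≤ (1 + ‖(leviForm ψ z).inverse‖ ^ 2) *
          ((‖leviForm ψ z‖ + 1) * fderiv ℝ ψ z (leviGrad ψ z)) := by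
        gcongr
        linarith
      _ = _ := by ring

lemma extDeriv_interiorProd (H : IsStrictlyPSHOn U ψ) {Ω : E → E [⋀^Fin 2]→L[ℝ] ℝ}
    (hΩ : ∀ z ∈ U, Ω z = negDDC ψ z) (hz : z ∈ U) :
    extDeriv (interiorProd (kahlerGradient Ω ψ) Ω) z = Ω z := by
  have h : interiorProd (kahlerGradient Ω ψ) Ω =ᶠ[𝓝 z] (-1 : ℝ) • dC ψ := by
    filter_upwards [H.isOpen.mem_nhds hz] with x hx
    ext v
    -- Writing `v = J(-Jv)` brings in the Levi form: `Ω(Z, v) = L(Z, -Jv) = -dψ(Jv)`, so `ι_Z Ω =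
    -- -d^ℂψ`.
    have hv : Matrix.vecCons (leviGrad ψ x) v = ![leviGrad ψ x, Complex.I • (-(Complex.I • v 0))] := by
      ext i
      fin_cases i
      · rfl
      · simp [I_smul_I_smul]
    simp only [interiorProd, ContinuousAlternatingMap.curryLeft_apply_apply,
      H.kahlerGradient_eq hΩ hx, hΩ x hx, dC_eq, Pi.smul_apply,
      ContinuousAlternatingMap.smul_apply, oneFormI_apply]
    rw [hv, negDDC_apply_I (H.contDiffAt hx), H.leviForm_grad hx]
    simp
  rw [h.extDeriv_eq, extDeriv_smul, hΩ z hz, negDDC, neg_one_smul]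

end IsStrictlyPSHOn
end Gradient

/-! ### Completeness of vector fields from a growth bound. -/

section Completeness

variable {E : Type*} [NormedAddCommGroup E] [NormedSpace ℝ E]

/-- A bounded Lipschitz vector field has integral curves for arbitrarily long times. -/
lemma exists_integralCurve_Ioo [CompleteSpace E] {W : E → E} {K L : NNReal} (hK : LipschitzWith K W)
    (hL : ∀ x, ‖W x‖ ≤ L) (p : E) {T : ℝ} (hT : 0 < T) :
    ∃ γ : ℝ → E, γ 0 = p ∧ ∀ t ∈ Ioo (-T) T, HasDerivAt γ (W (γ t)) t := by
  have hpl : IsPicardLindelof (fun _ => W) (tmin := -T) (tmax := T)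
      ⟨0, by simp [hT.le]⟩ p (L * ⟨T, hT.le⟩) 0 L K :=
    IsPicardLindelof.of_time_independent (fun x _ => hL x) hK.lipschitzOnWith (by simp; rfl)
  obtain ⟨γ, h0, h⟩ := hpl.exists_eq_forall_mem_Icc_hasDerivWithinAt₀
  exact ⟨γ, h0, fun t ht => (h t (Ioo_subset_Icc_self ht)).hasDerivAt (Icc_mem_nhds ht.1 ht.2)⟩

lemma integralCurve_eqOn {W : E → E} {K : NNReal} (hK : LipschitzWith K W) {T t₀ : ℝ}
    (ht₀ : t₀ ∈ Ioo (-T) T) {γ₁ γ₂ : ℝ → E} (h₁ : ∀ t ∈ Ioo (-T) T, HasDerivAt γ₁ (W (γ₁ t)) t)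
    (h₂ : ∀ t ∈ Ioo (-T) T, HasDerivAt γ₂ (W (γ₂ t)) t) (h : γ₁ t₀ = γ₂ t₀) :
    EqOn γ₁ γ₂ (Ioo (-T) T) :=
  ODE_solution_unique_of_mem_Ioo (v := fun _ => W) (s := fun _ => univ)
    (fun _ _ => hK.lipschitzOnWith) ht₀ (fun t ht => ⟨h₁ t ht, mem_univ _⟩)
    (fun t ht => ⟨h₂ t ht, mem_univ _⟩) h

/-- Cutting off a vector field outside a sublevel set of an exhausting function. -/
lemma exists_cutoff {U : Set E} (hU : IsOpen U) {ψ : E → ℝ} {Z : E → E}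
    (hψ : ContDiffOn ℝ ∞ ψ U) (hZ : ContDiffOn ℝ ∞ Z U) (hex : IsExhaustingOn U ψ) (c : ℝ) :
    ∃ (W : E → E) (K L : NNReal), LipschitzWith K W ∧ (∀ x, ‖W x‖ ≤ L) ∧
      (∀ z ∈ U, ψ z ≤ c → W z = Z z) ∧ (∀ z ∈ U, ∃ s ∈ Icc (0 : ℝ) 1, W z = s • Z z) ∧
      ∀ z ∉ U, W z = 0 := by
  classical
  -- The factor is `1` where `ψ ≤ c` and `0` where `ψ ≥ c + 1`, so the extension by zero is
  -- supported in a compact sublevel set.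
  set f : E → E := fun z => Real.smoothTransition (c + 1 - ψ z) • Z z with hf
  set S : Set E := {z | z ∈ U ∧ ψ z ≤ c + 1}
  have hS : IsCompact S := hex (c + 1)
  set W : E → E := U.indicator f with hW
  have hWS : ∀ z ∉ S, W z = 0 := fun z hz => by
    by_cases hzU : z ∈ U
    · have : c + 1 ≤ ψ z := by
        by_contra! h
        exact hz ⟨hzU, h.le⟩
      rw [hW, indicator_of_mem hzU, hf]
      simp only
      rw [Real.smoothTransition.zero_of_nonpos (by linarith), zero_smul]
    · exact indicator_of_notMem hzU _
  have hsupp : HasCompactSupport W := HasCompactSupport.intro hS hWS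
  have hdiff : ContDiff ℝ 1 W := by
    rw [contDiff_iff_contDiffAt]
    intro z
    by_cases hzU : z ∈ U
    · have h1 : ContDiffAt ℝ ∞ f z :=
        ((Real.smoothTransition.contDiff.contDiffAt.comp z
          (contDiffAt_const.sub (hψ.contDiffAt (hU.mem_nhds hzU)))).smul
          (hZ.contDiffAt (hU.mem_nhds hzU)))
      refine (h1.of_le (by norm_cast)).congr_of_eventuallyEq ?_
      filter_upwards [hU.mem_nhds hzU] with x hx using indicator_of_mem hx _
    · have h1 : W =ᶠ[𝓝 z] fun _ => 0 := by
        filter_upwards [hS.isClosed.isOpen_compl.mem_nhds (fun h => hzU h.1)] with x hx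
          using hWS x hx
      exact contDiffAt_const.congr_of_eventuallyEq h1
  obtain ⟨K, hK⟩ := hdiff.lipschitzWith_of_hasCompactSupport hsupp one_ne_zero
  obtain ⟨L, hL⟩ := hsupp.exists_bound_of_continuous hdiff.continuous
  refine ⟨W, K, L.toNNReal, hK, fun x => (hL x).trans (Real.le_coe_toNNReal L), ?_, ?_, ?_⟩
  · intro z hz hc
    rw [hW, indicator_of_mem hz, hf]
    simp only
    rw [Real.smoothTransition.one_of_one_le (by linarith), one_smul]
  · intro z hz
    exact ⟨_, ⟨Real.smoothTransition.nonneg _, Real.smoothTransition.le_one _⟩,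
      indicator_of_mem hz _⟩
  · exact fun z hz => indicator_of_notMem hz _

/-- A vector field along which an exhausting function `ψ` grows at most linearly in `ψ` is
complete. -/
theorem isCompleteOn_of_growth [CompleteSpace E] {U : Set E} (hU : IsOpen U) {ψ : E → ℝ} {Z : E → E}
    (hψ : ContDiffOn ℝ ∞ ψ U) (hZ : ContDiffOn ℝ ∞ Z U) (hex : IsExhaustingOn U ψ) {C : ℝ}
    (h0 : ∀ z ∈ U, 0 ≤ fderiv ℝ ψ z (Z z)) (h1 : ∀ z ∈ U, fderiv ℝ ψ z (Z z) ≤ ψ z + C) :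
    IsCompleteOn U Z := by
  intro p hp
  have hC : ∀ z ∈ U, 0 ≤ ψ z + C := fun z hz => (h0 z hz).trans (h1 z hz)
  set B : ℝ → ℝ := fun T => (ψ p + C) * Real.exp T - C with hB
  have hBmono : Monotone B := fun S T h => by
    have := mul_le_mul_of_nonneg_left (Real.exp_le_exp.2 h) (hC p hp)
    simp only [hB]
    linarith
  have hloc : ∀ T : ℝ, 0 < T → ∃ γ : ℝ → E, γ 0 = p ∧
      ∀ t ∈ Ioo (-T) T, γ t ∈ U ∧ ψ (γ t) ≤ B T ∧ HasDerivAt γ (Z (γ t)) t := by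
    intro T hT
    obtain ⟨W, K, L, hK, hL, hW1, hW2, hW3⟩ := exists_cutoff hU hψ hZ hex (B T)
    obtain ⟨γ, hγ0, hγ⟩ := exists_integralCurve_Ioo hK hL p hT
    have h0T : (0 : ℝ) ∈ Ioo (-T) T := ⟨by linarith, hT⟩
    -- Points outside `U` are zeros of `W`; by uniqueness a curve reaching one would be constant,
    -- contradicting the start in `U`.
    have hmem : ∀ t ∈ Ioo (-T) T, γ t ∈ U := fun t ht => by
      by_contra hn
      have heq := integralCurve_eqOn hK ht hγ (γ₂ := fun _ => γ t)
        (fun s _ => by rw [hW3 _ hn]; exact hasDerivAt_const s _) rfl h0T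
      rw [hγ0] at heq
      have hp' : p = γ t := heq
      exact hn (hp' ▸ hp)
    set y : ℝ → ℝ := fun t => ψ (γ t) + C with hy
    -- From `0 ≤ y' ≤ y`, `y` increases and `y e⁻ᵗ` decreases. So `ψ ≤ B T` along the curve, exactly
    -- the region where `W` agrees with `Z`.
    have hyd : ∀ t ∈ Ioo (-T) T, ∃ y', HasDerivAt y y' t ∧ 0 ≤ y' ∧ y' ≤ y t := fun t ht => by
      obtain ⟨s, hs, hWs⟩ := hW2 _ (hmem t ht)
      have hd : DifferentiableAt ℝ ψ (γ t) :=
        (hψ.contDiffAt (hU.mem_nhds (hmem t ht))).differentiableAt (by simp)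
      refine ⟨fderiv ℝ ψ (γ t) (W (γ t)),
        (hd.hasFDerivAt.comp_hasDerivAt t (hγ t ht)).add_const C, ?_, ?_⟩
      · rw [hWs, map_smul, smul_eq_mul]
        exact mul_nonneg hs.1 (h0 _ (hmem t ht))
      · rw [hWs, map_smul, smul_eq_mul]
        exact (mul_le_of_le_one_left (h0 _ (hmem t ht)) hs.2).trans (h1 _ (hmem t ht))
    have hyc : ContinuousOn y (Ioo (-T) T) := fun t ht => by
      obtain ⟨y', h, -⟩ := hyd t ht
      exact h.continuousAt.continuousWithinAt
    have hmono : MonotoneOn y (Ioo (-T) T) := by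
      refine monotoneOn_of_deriv_nonneg (convex_Ioo _ _) hyc (fun t ht => ?_) fun t ht => ?_
      all_goals
        rw [interior_Ioo] at ht
        obtain ⟨y', h, h', -⟩ := hyd t ht
      · exact h.differentiableAt.differentiableWithinAt
      · rwa [h.deriv]
    have hanti : AntitoneOn (fun t => y t * Real.exp (-t)) (Ioo (-T) T) := by
      have hder : ∀ t ∈ Ioo (-T) T, ∃ d, HasDerivAt (fun t => y t * Real.exp (-t)) d t ∧ d ≤ 0 :=
        fun t ht => by
          obtain ⟨y', h, -, h'⟩ := hyd t ht
          have he : HasDerivAt (fun t : ℝ => Real.exp (-t)) (Real.exp (-t) * -1) t :=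
            (hasDerivAt_neg t).exp
          refine ⟨_, h.mul he, ?_⟩
          have := mul_le_mul_of_nonneg_right h' (Real.exp_pos (-t)).le
          linarith
      refine antitoneOn_of_deriv_nonpos (convex_Ioo _ _)
        (hyc.mul (Real.continuous_exp.comp continuous_neg).continuousOn) (fun t ht => ?_)
        fun t ht => ?_
      all_goals
        rw [interior_Ioo] at ht
        obtain ⟨y', h, h'⟩ := hder t ht
      · exact h.differentiableAt.differentiableWithinAt
      · rwa [h.deriv]
    have hy0 : y 0 = ψ p + C := by simp [hy, hγ0]
    have hbound : ∀ t ∈ Ioo (-T) T, ψ (γ t) ≤ B T := fun t ht => by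
      suffices y t ≤ y 0 * Real.exp T by
        rw [hy0] at this
        simp only [hy] at this
        simp only [hB]
        linarith
      have hy0n : 0 ≤ y 0 := hy0 ▸ hC p hp
      rcases le_total t 0 with h | h
      · calc y t ≤ y 0 := hmono ht h0T h
          _ ≤ y 0 * Real.exp T := le_mul_of_one_le_right hy0n (Real.one_le_exp hT.le)
      · have h2 := hanti h0T ht h
        simp only [neg_zero, Real.exp_zero, mul_one] at h2
        calc y t = y t * Real.exp (-t) * Real.exp t := by
              rw [mul_assoc, ← Real.exp_add]; simp
          _ ≤ y 0 * Real.exp T := by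
              gcongr
              exact ht.2.le
    exact ⟨γ, hγ0, fun t ht => ⟨hmem t ht, hbound t ht,
      hW1 _ (hmem t ht) (hbound t ht) ▸ hγ t ht⟩⟩
  choose! γ hγ0 hγ using hloc
  have hcons : ∀ S T : ℝ, 0 < S → S ≤ T → EqOn (γ S) (γ T) (Ioo (-S) S) := fun S T hS hST => by
    obtain ⟨W, K, L, hK, -, hW, -⟩ := exists_cutoff hU hψ hZ hex (B T)
    refine integralCurve_eqOn hK (t₀ := 0) ⟨by linarith, hS⟩ (fun t ht => ?_) (fun t ht => ?_)
      ((hγ0 S hS).trans (hγ0 T (hS.trans_le hST)).symm)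
    · obtain ⟨ha, hb, hc⟩ := hγ S hS t ht
      rwa [hW _ ha (hb.trans (hBmono hST))]
    · obtain ⟨ha, hb, hc⟩ := hγ T (hS.trans_le hST) t
        ⟨by linarith [ht.1], by linarith [ht.2]⟩
      rwa [hW _ ha hb]
  have hmemIoo : ∀ t : ℝ, t ∈ Ioo (-(|t| + 1)) (|t| + 1) := fun t =>
    ⟨by linarith [neg_abs_le t], by linarith [le_abs_self t]⟩
  refine ⟨fun t => γ (|t| + 1) t, hγ0 _ (by positivity), fun t => ?_⟩
  have hpos : 0 < |t| + 1 := by positivity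
  refine ⟨(hγ _ hpos t (hmemIoo t)).1, ?_⟩
  -- The glued curve uses a different solution at every time. Within distance `1` of `t` all of them
  -- agree with the one on the interval of radius `|t| + 2`.
  have heq : (fun s => γ (|s| + 1) s) =ᶠ[𝓝 t] γ (|t| + 2) := by
    filter_upwards [Metric.ball_mem_nhds t one_pos] with s hs
    have hs' : |s| ≤ |t| + 1 := by
      rw [Metric.mem_ball, Real.dist_eq] at hs
      have := abs_sub_abs_le_abs_sub s t
      linarith
    exact hcons _ _ (by positivity) (by linarith) (hmemIoo s)
  have h := (hγ (|t| + 2) (by positivity) t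
    ⟨by linarith [neg_abs_le t], by linarith [le_abs_self t]⟩).2.2
  rw [← heq.eq_of_nhds] at h
  exact h.congr_of_eventuallyEq heq

end Completeness

/-! ### From strictly plurisubharmonic exhaustions to Liouville manifolds. -/

section PreWeinstein

variable {E : Type*} [NormedAddCommGroup E] [NormedSpace ℂ E]
  [NormedSpace ℝ E] [IsScalarTower ℝ ℂ E] [FiniteDimensional ℝ E]

lemma IsCompleteOn.congr {E : Type*} [NormedAddCommGroup E] [NormedSpace ℝ E] {U : Set E}
    {Z₁ Z₂ : E → E} (h : IsCompleteOn U Z₁) (hZ : EqOn Z₂ Z₁ U) : IsCompleteOn U Z₂ := by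
  intro p hp
  obtain ⟨γ, h0, hγ⟩ := h p hp
  refine ⟨γ, h0, fun t => ⟨(hγ t).1, ?_⟩⟩
  rw [hZ (hγ t).1]
  exact (hγ t).2

/-- A regular sublevel set of an exhausting function, bounded by a level above all critical
values, is an outward domain. -/
lemma exists_isOutwardDomain {E : Type*} [NormedAddCommGroup E] [NormedSpace ℝ E] {U : Set E}
    (hU : IsOpen U) {ψ : E → ℝ} {Z : E → E} (hψ : ContDiffOn ℝ ∞ ψ U)
    (hex : IsExhaustingOn U ψ) (hpos : ∀ z ∈ U, fderiv ℝ ψ z ≠ 0 → 0 < fderiv ℝ ψ z (Z z))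
    {K : Set E} (hK : IsCompact K) (hKU : K ⊆ U) (hcrit : critSet U ψ ⊆ K) :
    ∃ X₀ : Set E, IsOutwardDomain U Z X₀ ∧ ∀ z ∈ U \ X₀, Z z ≠ 0 := by
  obtain ⟨c, hc⟩ : ∃ c, ∀ z ∈ K, ψ z < c := by
    obtain ⟨b, hb⟩ := hK.bddAbove_image (hψ.continuousOn.mono hKU)
    exact ⟨b + 1, fun z hz => by linarith [hb (mem_image_of_mem ψ hz)]⟩
  have hreg : ∀ z ∈ U, c ≤ ψ z → 0 < fderiv ℝ ψ z (Z z) := fun z hz hcz => by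
    refine hpos z hz fun h => ?_
    exact absurd (hc z (hcrit ⟨hz, h⟩)) (not_lt.2 hcz)
  have hcpt := hex c
  refine ⟨{z | z ∈ U ∧ ψ z ≤ c}, ⟨hcpt, fun z hz => hz.1, fun p hp => ?_⟩, fun z hz h => ?_⟩
  · have hpX := hcpt.isClosed.frontier_subset hp
    refine ⟨U, fun z => ψ z - c, hU, hpX.1, hψ.sub contDiffOn_const, ?_, ?_⟩
    · ext z
      simp only [mem_inter_iff, mem_ofPred_eq, sub_nonpos]
      tauto
    -- The set `ψ < c` is open and lies in the sublevel set, so a frontier point is on the level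
    -- `c`, above the critical values.
    · have hpc : c ≤ ψ p := by
        by_contra! h
        have ho : IsOpen (U ∩ ψ ⁻¹' Iio c) := hψ.continuousOn.isOpen_inter_preimage hU isOpen_Iio
        exact hp.2 (mem_interior.2 ⟨_, fun z hz => ⟨hz.1, (mem_Iio.1 hz.2).le⟩, ho, hpX.1, h⟩)
      rw [fderiv_sub_const]
      exact hreg p hpX.1 hpc
  · have hcz : c ≤ ψ z := by
      by_contra! h'
      exact hz.2 ⟨hz.1, h'.le⟩
    have := hreg z hz.1 hcz
    simp [h] at this

/-- A strictly plurisubharmonic exhausting function with compact critical set and linearly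
bounded gradient growth defines a Liouville manifold for which it is a Lyapunov function. -/
theorem IsStrictlyPSHOn.isPreWeinsteinManifold {U : Set E} {ψ : E → ℝ} (H : IsStrictlyPSHOn U ψ)
    {Ω : E → E [⋀^Fin 2]→L[ℝ] ℝ} (hΩ : ∀ z ∈ U, Ω z = negDDC ψ z) (hex : IsExhaustingOn U ψ)
    {K : Set E} (hK : IsCompact K) (hKU : K ⊆ U) (hcrit : critSet U ψ ⊆ K) {C : ℝ}
    (hgrowth : ∀ z ∈ U, fderiv ℝ ψ z (leviGrad ψ z) ≤ ψ z + C) :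
    IsPreWeinsteinManifold U Ω (kahlerGradient Ω ψ) ψ := by
  have : CompleteSpace E := FiniteDimensional.complete ℝ E
  have hZ : EqOn (kahlerGradient Ω ψ) (leviGrad ψ) U := fun z hz => H.kahlerGradient_eq hΩ hz
  refine ⟨⟨H.isOpen, H.isSymplecticFormOn hΩ, H.contDiffOn_grad.congr hZ, ?_,
    fun z hz => H.extDeriv_interiorProd hΩ hz, ?_⟩, H.smooth, hex, ?_⟩
  · exact (isCompleteOn_of_growth H.isOpen H.smooth H.contDiffOn_grad hex
      (fun z hz => H.fderiv_grad_nonneg hz) hgrowth).congr hZ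
  · refine exists_isOutwardDomain H.isOpen H.smooth hex (fun z hz h => ?_) hK hKU hcrit
    rw [hZ hz]
    exact H.fderiv_grad_pos hz h
  · obtain ⟨δ, hδ, h⟩ := H.isLyapunovOn_grad
    refine ⟨δ, hδ, fun z hz => ?_⟩
    rw [hZ hz]
    exact h z hz

end PreWeinstein

/-! ### Levi forms of sums and of squared moduli of holomorphic functions. -/

section LeviFormComputations

variable {E : Type*} [NormedAddCommGroup E] [NormedSpace ℂ E]
  [NormedSpace ℝ E] [IsScalarTower ℝ ℂ E] {z : E}

lemma ContDiffAt.eventually_differentiableAt {E F : Type*} [NormedAddCommGroup E]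
    [NormedSpace ℝ E] [NormedAddCommGroup F] [NormedSpace ℝ F] {f : E → F} {z : E}
    (h : ContDiffAt ℝ ∞ f z) : ∀ᶠ x in 𝓝 z, DifferentiableAt ℝ f x := by
  filter_upwards [(h.of_le (m := 1) (by norm_cast)).eventually (by simp)] with x hx
  exact hx.differentiableAt one_ne_zero

lemma ContDiffAt.differentiableAt_fderiv {E F : Type*} [NormedAddCommGroup E]
    [NormedSpace ℝ E] [NormedAddCommGroup F] [NormedSpace ℝ F] {f : E → F} {z : E}
    (h : ContDiffAt ℝ ∞ f z) : DifferentiableAt ℝ (fderiv ℝ f) z :=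
  (h.fderiv_right (m := 1) (by norm_cast)).differentiableAt one_ne_zero

lemma fderiv_fderiv_add {E F : Type*} [NormedAddCommGroup E]
    [NormedSpace ℝ E] [NormedAddCommGroup F] [NormedSpace ℝ F] {f g : E → F} {z : E}
    (hf : ContDiffAt ℝ ∞ f z) (hg : ContDiffAt ℝ ∞ g z) :
    fderiv ℝ (fderiv ℝ fun x => f x + g x) z =
      fderiv ℝ (fderiv ℝ f) z + fderiv ℝ (fderiv ℝ g) z := by
  have h : (fderiv ℝ fun x => f x + g x) =ᶠ[𝓝 z] fun x => fderiv ℝ f x + fderiv ℝ g x := by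
    filter_upwards [hf.eventually_differentiableAt, hg.eventually_differentiableAt] with x hx hy
    exact fderiv_fun_add hx hy
  rw [h.fderiv_eq, fderiv_fun_add hf.differentiableAt_fderiv hg.differentiableAt_fderiv]

lemma leviForm_add {ψ₁ ψ₂ : E → ℝ} (h₁ : ContDiffAt ℝ ∞ ψ₁ z) (h₂ : ContDiffAt ℝ ∞ ψ₂ z)
    (u v : E) : leviForm (fun x => ψ₁ x + ψ₂ x) z u v = leviForm ψ₁ z u v + leviForm ψ₂ z u v := by
  simp only [leviForm_apply, fderiv_fderiv_add h₁ h₂, add_apply]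
  ring

lemma leviForm_sum {ι : Type*} (s : Finset ι) {ψ : ι → E → ℝ}
    (h : ∀ i, ContDiffAt ℝ ∞ (ψ i) z) (u v : E) :
    leviForm (fun x => ∑ i ∈ s, ψ i x) z u v = ∑ i ∈ s, leviForm (ψ i) z u v := by
  classical
  induction s using Finset.induction_on with
  | empty => simp [leviForm_apply]
  | insert i s hi ih =>
    simp only [Finset.sum_insert hi]
    rw [leviForm_add (h i) (ContDiffAt.sum fun i _ => h i), ih]

lemma contDiffAt_norm_sq {f : E → ℂ} (h : ContDiffAt ℂ ∞ f z) :
    ContDiffAt ℝ ∞ (fun x => ‖f x‖ ^ 2) z :=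
  (h.restrict_scalars ℝ).norm_sq ℝ

lemma hasFDerivAt_real {F : Type*} [NormedAddCommGroup F] [NormedSpace ℂ F] [NormedSpace ℝ F]
    [IsScalarTower ℝ ℂ F] {f : E → F} (h : DifferentiableAt ℂ f z) :
    HasFDerivAt f ((fderiv ℂ f z).restrictScalars ℝ) z :=
  h.hasFDerivAt.restrictScalars ℝ

lemma fderiv_norm_sq_comp {f : E → ℂ} (h : DifferentiableAt ℂ f z) (v : E) :
    fderiv ℝ (fun x => ‖f x‖ ^ 2) z v = 2 * inner ℝ (f z) (fderiv ℂ f z v) := by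
  rw [((hasFDerivAt_real h).norm_sq).fderiv]
  simp
  ring

lemma inner_I_mul (a b : ℂ) : inner ℝ (Complex.I * a) (Complex.I * b) = inner ℝ a b := by
  simp [Complex.inner]

/-- The Levi form of the squared modulus of a holomorphic function. -/
lemma leviForm_norm_sq {f : E → ℂ} (h : ContDiffAt ℂ ∞ f z) (u v : E) :
    leviForm (fun x => ‖f x‖ ^ 2) z u v = 4 * inner ℝ (fderiv ℂ f z u) (fderiv ℂ f z v) := by
  have hd : DifferentiableAt ℂ f z := h.differentiableAt (by simp)
  have hd2 : DifferentiableAt ℂ (fderiv ℂ f) z :=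
    (h.fderiv_right (m := 1) (by norm_cast)).differentiableAt one_ne_zero
  have hev : ∀ᶠ x in 𝓝 z, DifferentiableAt ℂ f x := by
    filter_upwards [(h.of_le (m := 1) (by norm_cast)).eventually (by simp)] with x hx
    exact hx.differentiableAt one_ne_zero
  have key : ∀ u v, fderiv ℝ (fderiv ℝ fun x => ‖f x‖ ^ 2) z u v =
      2 * (inner ℝ (f z) (fderiv ℂ (fderiv ℂ f) z u v) +
        inner ℝ (fderiv ℂ f z u) (fderiv ℂ f z v)) := fun u v => by
    have h1 : fderiv ℝ (fderiv ℝ fun x => ‖f x‖ ^ 2) z u v =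
        fderiv ℝ (fun x => fderiv ℝ (fun x => ‖f x‖ ^ 2) x v) z u := by
      rw [fderiv_clm_apply (contDiffAt_norm_sq h).differentiableAt_fderiv
        (differentiableAt_const v)]
      simp
    have h2 : (fun x => fderiv ℝ (fun x => ‖f x‖ ^ 2) x v) =ᶠ[𝓝 z]
        fun x => 2 * inner ℝ (f x) (fderiv ℂ f x v) := by
      filter_upwards [hev] with x hx using fderiv_norm_sq_comp hx v
    have h3 : HasFDerivAt (fun x => fderiv ℂ f x v)
        (((fderiv ℂ (fderiv ℂ f) z).flip v).restrictScalars ℝ) z := by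
      have := (hd2.hasFDerivAt.clm_apply (hasFDerivAt_const v z)).restrictScalars ℝ
      refine this.congr_fderiv ?_
      ext w
      simp
    have h4 := ((hasFDerivAt_real hd).inner ℝ h3).const_mul 2
    rw [h1, h2.fderiv_eq, h4.fderiv]
    simp
  -- The second derivative of `f` is complex bilinear, so its values at `(u, v)` and `(Ju, Jv)` are
  -- opposite and cancel; only first derivatives remain.
  rw [leviForm_apply, key, key]
  simp only [map_smul, smul_apply, smul_eq_mul, inner_I_mul]
  rw [← mul_assoc, Complex.I_mul_I, neg_one_mul, inner_neg_right]
  ring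

end LeviFormComputations

/-! ### The potential of an arrangement: Kähler form, growth and differential. -/

namespace HyperplaneArrangement

variable {d n : ℕ} (𝕍 : HyperplaneArrangement d n)

/-- The linear part of the complexified affine form `ℓᵢ`. -/
noncomputable def form (i : Fin n) : (Fin d → ℂ) →L[ℂ] ℂ :=
  ∑ j, (𝕍.a i j : ℂ) • ContinuousLinearMap.proj j

lemma form_apply (i : Fin n) (z : Fin d → ℂ) : 𝕍.form i z = ∑ j, (𝕍.a i j : ℂ) * z j := by
  simp [form]

lemma ell_eq (i : Fin n) (z : Fin d → ℂ) : 𝕍.ell i z = 𝕍.form i z + 𝕍.w i := by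
  rw [form_apply, ell]

lemma ell_sub (i : Fin n) (z v : Fin d → ℂ) : 𝕍.ell i z - 𝕍.ell i v = 𝕍.form i (z - v) := by
  simp [ell_eq]

lemma eq_zero_of_form {z : Fin d → ℂ} (h : ∀ i, 𝕍.form i z = 0) : z = 0 := by
  have hre : (fun j => (z j).re) = 0 := by
    refine 𝕍.injective ?_
    ext i
    have := congrArg Complex.re (h i)
    simpa [form_apply, Matrix.mulVec, dotProduct] using this
  have him : (fun j => (z j).im) = 0 := by
    refine 𝕍.injective ?_
    ext i
    have := congrArg Complex.im (h i)
    simpa [form_apply, Matrix.mulVec, dotProduct] using this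
  ext j
  exact Complex.ext (congrFun hre j) (congrFun him j)

lemma mem_complement {z : Fin d → ℂ} : z ∈ 𝕍.complement ↔ ∀ i, 𝕍.ell i z ≠ 0 := by
  simp [complement, hyperplane]

lemma hasFDerivAt_ell (i : Fin n) (z : Fin d → ℂ) : HasFDerivAt (𝕍.ell i) (𝕍.form i) z := by
  have : 𝕍.ell i = fun z => 𝕍.form i z + 𝕍.w i := funext fun z => 𝕍.ell_eq i z
  rw [this]
  exact (𝕍.form i).hasFDerivAt.add_const _

lemma contDiff_ell (i : Fin n) : ContDiff ℂ ∞ (𝕍.ell i) := by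
  have : 𝕍.ell i = fun z => 𝕍.form i z + 𝕍.w i := funext fun z => 𝕍.ell_eq i z
  rw [this]
  exact (𝕍.form i).contDiff.add contDiff_const

lemma continuous_ell (i : Fin n) : Continuous (𝕍.ell i) := (𝕍.contDiff_ell i).continuous

lemma isOpen_complement : IsOpen 𝕍.complement := by
  have : 𝕍.complement = ⋂ i, {z | 𝕍.ell i z ≠ 0} := by
    ext z
    simp [mem_complement]
  rw [this]
  exact isOpen_iInter_of_finite fun i => isOpen_ne_fun (𝕍.continuous_ell i) continuous_const

variable {𝕍} {z : Fin d → ℂ}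

lemma contDiffAt_embed (hz : z ∈ 𝕍.complement) (j : Fin n ⊕ Fin n) :
    ContDiffAt ℂ ∞ (fun x => 𝕍.embed x j) z := by
  rcases j with i | i
  · exact (𝕍.contDiff_ell i).contDiffAt
  · exact (𝕍.contDiff_ell i).contDiffAt.inv (𝕍.mem_complement.1 hz i)

lemma differentiableAt_embed (hz : z ∈ 𝕍.complement) (j : Fin n ⊕ Fin n) :
    DifferentiableAt ℂ (fun x => 𝕍.embed x j) z :=
  (contDiffAt_embed hz j).differentiableAt (by simp)

lemma fderiv_embed_inl (i : Fin n) : fderiv ℂ (fun x => 𝕍.embed x (.inl i)) z = 𝕍.form i :=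
  (𝕍.hasFDerivAt_ell i z).fderiv

lemma fderiv_embed_inr (hz : z ∈ 𝕍.complement) (i : Fin n) (v : Fin d → ℂ) :
    fderiv ℂ (fun x => 𝕍.embed x (.inr i)) z v = -(𝕍.form i v / 𝕍.ell i z ^ 2) := by
  have h := (hasDerivAt_inv (𝕍.mem_complement.1 hz i)).comp_hasFDerivAt z (𝕍.hasFDerivAt_ell i z)
  have h' : fderiv ℂ (fun x => 𝕍.embed x (.inr i)) z = _ := h.fderiv
  rw [h']
  simp
  ring

variable (𝕍) in
lemma potential_eq : 𝕍.potential = fun z => ∑ j, ‖𝕍.embed z j‖ ^ 2 := by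
  funext z
  simp [potential, embed, Fintype.sum_sum_type, Finset.sum_add_distrib]

lemma contDiffAt_potential (hz : z ∈ 𝕍.complement) : ContDiffAt ℝ ∞ 𝕍.potential z := by
  rw [potential_eq]
  exact ContDiffAt.sum fun j _ => contDiffAt_norm_sq (contDiffAt_embed hz j)

variable (𝕍) in
lemma contDiffOn_potential : ContDiffOn ℝ ∞ 𝕍.potential 𝕍.complement :=
  fun _ hz => (contDiffAt_potential hz).contDiffWithinAt

lemma fderiv_potential_embed (hz : z ∈ 𝕍.complement) (v : Fin d → ℂ) :
    fderiv ℝ 𝕍.potential z v =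
      ∑ j, 2 * inner ℝ (𝕍.embed z j) (fderiv ℂ (fun x => 𝕍.embed x j) z v) := by
  rw [potential_eq, fderiv_fun_sum fun j _ =>
    (contDiffAt_norm_sq (contDiffAt_embed hz j)).differentiableAt (by simp), sum_apply]
  exact Finset.sum_congr rfl fun j _ => fderiv_norm_sq_comp (differentiableAt_embed hz j) v

lemma leviForm_potential (hz : z ∈ 𝕍.complement) (u v : Fin d → ℂ) :
    leviForm 𝕍.potential z u v = ∑ j, 4 * inner ℝ (fderiv ℂ (fun x => 𝕍.embed x j) z u)
      (fderiv ℂ (fun x => 𝕍.embed x j) z v) := by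
  rw [potential_eq, leviForm_sum _ fun j => contDiffAt_norm_sq (contDiffAt_embed hz j)]
  exact Finset.sum_congr rfl fun j _ => leviForm_norm_sq (contDiffAt_embed hz j) u v

variable (𝕍) in
lemma isStrictlyPSHOn_potential : IsStrictlyPSHOn 𝕍.complement 𝕍.potential where
  isOpen := 𝕍.isOpen_complement
  smooth := 𝕍.contDiffOn_potential
  pos z hz u hu := by
    obtain ⟨i, hi⟩ : ∃ i, 𝕍.form i u ≠ 0 := by
      by_contra! h
      exact hu (𝕍.eq_zero_of_form h)
    rw [leviForm_potential hz]
    refine Finset.sum_pos' (fun j _ => by rw [real_inner_self_eq_norm_sq]; positivity)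
      ⟨.inl i, Finset.mem_univ _, ?_⟩
    rw [real_inner_self_eq_norm_sq, fderiv_embed_inl]
    positivity

lemma fderiv_real_embed (hz : z ∈ 𝕍.complement) (v : Fin d → ℂ) (j : Fin n ⊕ Fin n) :
    fderiv ℝ 𝕍.embed z v j = fderiv ℂ (fun x => 𝕍.embed x j) z v := by
  have h : HasFDerivAt 𝕍.embed (ContinuousLinearMap.pi fun j =>
      (fderiv ℂ (fun x => 𝕍.embed x j) z).restrictScalars ℝ) z :=
    hasFDerivAt_pi.2 fun j => hasFDerivAt_real (differentiableAt_embed hz j)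
  rw [h.fderiv]
  rfl

/-- The function `φ` is a Kähler potential. -/
lemma omega_eq (hz : z ∈ 𝕍.complement) : 𝕍.omega z = negDDC 𝕍.potential z := by
  ext v
  have hv : v = ![v 0, Complex.I • (-(Complex.I • v 1))] := by
    ext i : 1
    fin_cases i
    · rfl
    · simp [I_smul_I_smul]
  rw [hv, negDDC_apply_I (contDiffAt_potential hz), leviForm_potential hz]
  set w := -(Complex.I • v 1)
  change 4 * ∑ j, ((fderiv ℝ 𝕍.embed z (v 0) j).re * (fderiv ℝ 𝕍.embed z (Complex.I • w) j).im -
    (fderiv ℝ 𝕍.embed z (v 0) j).im * (fderiv ℝ 𝕍.embed z (Complex.I • w) j).re) = _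
  rw [Finset.mul_sum]
  refine Finset.sum_congr rfl fun j _ => ?_
  rw [fderiv_real_embed hz, fderiv_real_embed hz]
  simp [Complex.inner]
  ring

/-- Summing `4⟨fⱼ, dfⱼ Z⟩ ≤ |fⱼ|² + 4|dfⱼ Z|²` gives `2 dφ(Z) ≤ φ + dφ(Z)`, because `∑ 4|dfⱼ Z|² =
L(Z, Z) = dφ(Z)`. -/
lemma fderiv_potential_grad_le (hz : z ∈ 𝕍.complement) :
    fderiv ℝ 𝕍.potential z (leviGrad 𝕍.potential z) ≤ 𝕍.potential z := by
  set Z := leviGrad 𝕍.potential z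
  have h1 : fderiv ℝ 𝕍.potential z Z = _ := fderiv_potential_embed hz Z
  have h2 : fderiv ℝ 𝕍.potential z Z = _ :=
    (congrArg (· Z) (𝕍.isStrictlyPSHOn_potential.leviForm_grad hz)).symm.trans
      (leviForm_potential hz Z Z)
  have h3 : 𝕍.potential z = ∑ j, ‖𝕍.embed z j‖ ^ 2 := congrFun 𝕍.potential_eq z
  have h4 : 2 * fderiv ℝ 𝕍.potential z Z ≤ 𝕍.potential z + fderiv ℝ 𝕍.potential z Z := by
    nth_rewrite 2 [h2]
    rw [h1, h3, Finset.mul_sum, ← Finset.sum_add_distrib]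
    refine Finset.sum_le_sum fun j _ => ?_
    have := real_inner_le_norm (𝕍.embed z j) (fderiv ℂ (fun x => 𝕍.embed x j) z Z)
    rw [real_inner_self_eq_norm_sq]
    nlinarith [sq_nonneg (‖𝕍.embed z j‖ - 2 * ‖fderiv ℂ (fun x => 𝕍.embed x j) z Z‖)]
  linarith

lemma inner_inv_neg_div {a l : ℂ} (hl : l ≠ 0) :
    inner ℝ l⁻¹ (-(a / l ^ 2)) = -((‖l‖ ^ 4)⁻¹ * inner ℝ l a) := by
  have hc : (starRingEnd ℂ) l ≠ 0 := by simpa using hl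
  have h : (starRingEnd ℂ) l⁻¹ * (-(a / l ^ 2)) =
      ((-(‖l‖ ^ 4)⁻¹ : ℝ) : ℂ) * ((starRingEnd ℂ) l * a) := by
    have hn : ((‖l‖ : ℂ)) ^ 2 = l * (starRingEnd ℂ) l := (Complex.mul_conj' l).symm
    have hn4 : ((‖l‖ : ℂ)) ^ 4 = (l * (starRingEnd ℂ) l) ^ 2 := by rw [← hn]; ring
    push_cast
    rw [hn4, map_inv₀]
    field_simp
  simp only [Complex.inner]
  rw [mul_comm, h, Complex.re_ofReal_mul, mul_comm a]
  ring

lemma fderiv_potential (hz : z ∈ 𝕍.complement) (v : Fin d → ℂ) :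
    fderiv ℝ 𝕍.potential z v =
      ∑ i, 2 * ((1 - (‖𝕍.ell i z‖ ^ 4)⁻¹) * inner ℝ (𝕍.ell i z) (𝕍.form i v)) := by
  rw [fderiv_potential_embed hz, Fintype.sum_sum_type, ← Finset.sum_add_distrib]
  refine Finset.sum_congr rfl fun i _ => ?_
  rw [fderiv_embed_inl, fderiv_embed_inr hz]
  simp only [embed, Sum.elim_inl, Sum.elim_inr]
  rw [inner_inv_neg_div (𝕍.mem_complement.1 hz i)]
  ring

end HyperplaneArrangement

/-- Every linear map between finite-dimensional spaces has a generalized inverse. -/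
lemma LinearMap.exists_comp_comp_eq {𝕜 V W : Type*} [Field 𝕜] [AddCommGroup V] [Module 𝕜 V]
    [AddCommGroup W] [Module 𝕜 W] (A : V →ₗ[𝕜] W) : ∃ B : W →ₗ[𝕜] V, ∀ x, A (B (A x)) = A x := by
  obtain ⟨s, hs⟩ := A.rangeRestrict.exists_rightInverse_of_surjective A.range_rangeRestrict
  obtain ⟨B, hB⟩ := s.exists_extend
  refine ⟨B, fun x => ?_⟩
  have h1 : B (A x) = s (A.rangeRestrict x) := LinearMap.congr_fun hB (A.rangeRestrict x)
  have h2 := LinearMap.congr_fun hs (A.rangeRestrict x)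
  rw [h1]
  exact congrArg Subtype.val h2

/-! ### Exhaustion and compactness of the critical set. -/

namespace HyperplaneArrangement

variable {d n : ℕ} (𝕍 : HyperplaneArrangement d n) {z : Fin d → ℂ}

/-- A bound on the values of the `ℓᵢ` bounds the point. -/
lemma exists_norm_le (R : ℝ) : ∃ C, ∀ z, (∀ i, ‖𝕍.ell i z‖ ≤ R) → ‖z‖ ≤ C := by
  set A : (Fin d → ℂ) →L[ℂ] (Fin n → ℂ) := ContinuousLinearMap.pi 𝕍.form
  have hA : LinearMap.ker (A : (Fin d → ℂ) →ₗ[ℂ] (Fin n → ℂ)) = ⊥ :=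
    LinearMap.ker_eq_bot'.2 fun z hz => 𝕍.eq_zero_of_form fun i => congrFun hz i
  obtain ⟨K, -, hK⟩ := LinearMap.exists_antilipschitzWith _ hA
  refine ⟨K * (|R| + ∑ i, |𝕍.w i|), fun z hz => ?_⟩
  have h1 := hK.le_mul_dist z 0
  rw [map_zero, dist_zero_right, dist_zero_right] at h1
  refine h1.trans (mul_le_mul_of_nonneg_left ?_ K.2)
  refine (pi_norm_le_iff_of_nonneg (by positivity)).2 fun i => ?_
  have h2 : A z i = 𝕍.ell i z - 𝕍.w i := by
    rw [ell_eq, add_sub_cancel_right]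
    rfl
  calc ‖A z i‖ ≤ ‖𝕍.ell i z‖ + ‖(𝕍.w i : ℂ)‖ := by rw [h2]; exact norm_sub_le _ _
    _ ≤ |R| + |𝕍.w i| := by
      rw [Complex.norm_real, Real.norm_eq_abs]
      exact add_le_add_left ((hz i).trans (le_abs_self R)) _
    _ ≤ _ := by
      gcongr
      exact Finset.single_le_sum (f := fun i => |𝕍.w i|) (fun _ _ => abs_nonneg _)
        (Finset.mem_univ i)

lemma term_le_potential (z : Fin d → ℂ) (i : Fin n) :
    ‖𝕍.ell i z‖ ^ 2 + (‖𝕍.ell i z‖ ^ 2)⁻¹ ≤ 𝕍.potential z :=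
  Finset.single_le_sum (f := fun i => ‖𝕍.ell i z‖ ^ 2 + (‖𝕍.ell i z‖ ^ 2)⁻¹)
    (fun _ _ => by positivity) (Finset.mem_univ i)

lemma potential_nonneg (z : Fin d → ℂ) : 0 ≤ 𝕍.potential z :=
  Finset.sum_nonneg fun _ _ => by positivity

lemma isExhaustingOn_potential : IsExhaustingOn 𝕍.complement 𝕍.potential := by
  intro c
  -- On the hyperplanes the convention `0⁻¹ = 0` makes `φ` finite but discontinuous. `T` is closed
  -- in `ℂᵈ`, avoids the hyperplanes and contains the sublevel set, so closedness can be tested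
  -- inside it.
  set T : Set (Fin d → ℂ) := {z | ∀ i, 1 ≤ c * ‖𝕍.ell i z‖ ^ 2}
  have hT : IsClosed T := by
    simp only [T, ofPred_forall]
    exact isClosed_iInter fun i => isClosed_le continuous_const
      (continuous_const.mul ((𝕍.continuous_ell i).norm.pow 2))
  have hTU : T ⊆ 𝕍.complement := fun z hz => 𝕍.mem_complement.2 fun i h => by
    have := hz i
    simp [h] at this
    linarith
  have heq : {z | z ∈ 𝕍.complement ∧ 𝕍.potential z ≤ c} = T ∩ 𝕍.potential ⁻¹' Iic c := by
    ext z
    refine ⟨fun h => ⟨fun i => ?_, h.2⟩, fun h => ⟨hTU h.1, h.2⟩⟩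
    have hpos : 0 < ‖𝕍.ell i z‖ ^ 2 := by
      have := 𝕍.mem_complement.1 h.1 i
      positivity
    have h2 := (𝕍.term_le_potential z i).trans h.2
    rw [← inv_le_iff_one_le_mul₀ hpos]
    linarith
  rw [heq]
  refine Metric.isCompact_of_isClosed_isBounded
    ((𝕍.contDiffOn_potential.continuousOn.mono hTU).preimage_isClosed_of_isClosed hT isClosed_Iic) ?_
  obtain ⟨C, hC⟩ := 𝕍.exists_norm_le (c + 1)
  refine (Metric.isBounded_closedBall (x := (0 : Fin d → ℂ)) (r := C)).subset fun z hz => ?_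
  rw [mem_closedBall_zero_iff]
  refine hC z fun i => ?_
  have h1 : 𝕍.potential z ≤ c := hz.2
  have h2 := 𝕍.term_le_potential z i
  have h3 : 0 ≤ (‖𝕍.ell i z‖ ^ 2)⁻¹ := by positivity
  nlinarith [sq_nonneg (‖𝕍.ell i z‖ - 1), sq_nonneg (‖𝕍.ell i z‖)]

/-- Every vector can be moved into a coordinate subspace `{form i = 0, i ∈ I}` at a cost
controlled by the values `form i`, `i ∈ I`. -/
lemma exists_projection : ∃ C : ℝ, 0 ≤ C ∧ ∀ (I : Finset (Fin n)) (z : Fin d → ℂ),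
    ∃ v, (∀ i ∈ I, 𝕍.form i v = 0) ∧ ∀ R, 0 ≤ R → (∀ i ∈ I, ‖𝕍.form i z‖ ≤ R) →
      ∀ k, ‖𝕍.form k v - 𝕍.form k z‖ ≤ C * R := by
  classical
  have hI : ∀ I : Finset (Fin n), ∃ C : ℝ, 0 ≤ C ∧ ∀ z : Fin d → ℂ,
      ∃ v, (∀ i ∈ I, 𝕍.form i v = 0) ∧ ∀ R, 0 ≤ R → (∀ i ∈ I, ‖𝕍.form i z‖ ≤ R) →
        ∀ k, ‖𝕍.form k v - 𝕍.form k z‖ ≤ C * R := by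
    intro I
    set A : (Fin d → ℂ) →ₗ[ℂ] (I → ℂ) := LinearMap.pi fun i => (𝕍.form i : (Fin d → ℂ) →ₗ[ℂ] ℂ)
    obtain ⟨B, hB⟩ := A.exists_comp_comp_eq
    set D : (I → ℂ) →L[ℂ] (Fin n → ℂ) :=
      (ContinuousLinearMap.pi 𝕍.form) ∘L LinearMap.toContinuousLinearMap B
    -- With `B` a generalized inverse, `z - B A z` lies in the kernel of `A`, and the displacement
    -- depends only on `A z`.
    refine ⟨‖D‖, norm_nonneg _, fun z => ⟨z - B (A z), fun i hi => ?_, fun R hR hz k => ?_⟩⟩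
    · have := congrFun (hB z) ⟨i, hi⟩
      rw [map_sub, sub_eq_zero]
      exact this.symm
    · have h1 : 𝕍.form k (z - B (A z)) - 𝕍.form k z = -(D (A z) k) := by
        rw [map_sub, sub_sub_cancel_left]
        rfl
      rw [h1, norm_neg]
      calc ‖D (A z) k‖ ≤ ‖D (A z)‖ := norm_le_pi_norm _ k
        _ ≤ ‖D‖ * ‖A z‖ := D.le_opNorm _
        _ ≤ ‖D‖ * R := by
          gcongr
          exact (pi_norm_le_iff_of_nonneg hR).2 fun i => hz i i.2
  -- There are finitely many `I`, so the sum of their constants serves for all.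
  choose C hC0 hC using hI
  refine ⟨∑ I, C I, Finset.sum_nonneg fun I _ => hC0 I, fun I z => ?_⟩
  obtain ⟨v, hv, h⟩ := hC I z
  refine ⟨v, hv, fun R hR hz k => (h R hR hz k).trans ?_⟩
  gcongr
  exact Finset.single_le_sum (f := C) (fun I _ => hC0 I) (Finset.mem_univ I)

/-- The critical points of the potential are bounded. -/
lemma exists_critSet_bound : ∃ R, ∀ z ∈ critSet 𝕍.complement 𝕍.potential, ‖z‖ ≤ R := by
  classical
  obtain ⟨C, hC0, hC⟩ := 𝕍.exists_projection
  set W : ℝ := 1 + ∑ i, |𝕍.w i|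
  have hW0 : 0 ≤ W := by positivity
  -- the displacement of `ℓ_k` along the projection
  set M : ℝ := C * W + W with hM
  have hM0 : 0 ≤ M := by positivity
  have hwW : ∀ i, |𝕍.w i| + 1 ≤ W := fun i => by
    have := Finset.single_le_sum (f := fun i => |𝕍.w i|) (fun _ _ => abs_nonneg _)
        (Finset.mem_univ i)
    simp only [W]
    linarith
  obtain ⟨R, hR⟩ := 𝕍.exists_norm_le (1 + n * (2 + M ^ 2))
  refine ⟨R, fun z ⟨hz, hcrit⟩ => hR z ?_⟩
  set I : Finset (Fin n) := Finset.univ.filter fun i => ‖𝕍.ell i z‖ ≤ 1 with hI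
  obtain ⟨v, hv, hvz⟩ := hC I z
  have hform : ∀ i, 𝕍.form i z = 𝕍.ell i z - 𝕍.w i := fun i => by
    rw [ell_eq, add_sub_cancel_right]
  have hvz' := hvz W hW0 fun i hi => by
    rw [hform]
    refine (norm_sub_le _ _).trans ?_
    rw [Complex.norm_real, Real.norm_eq_abs]
    have := (Finset.mem_filter.1 hi).2
    linarith [hwW i]
  have hdisp : ∀ k, ‖𝕍.form k v - 𝕍.ell k z‖ ≤ M := fun k => by
    have h1 : 𝕍.form k v - 𝕍.ell k z = (𝕍.form k v - 𝕍.form k z) - (𝕍.w k : ℂ) := by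
      rw [hform]; ring
    rw [h1]
    refine (norm_sub_le _ _).trans ?_
    rw [Complex.norm_real, Real.norm_eq_abs]
    linarith [hvz' k, hwW k]
  have hsum : ∑ i, 2 * ((1 - (‖𝕍.ell i z‖ ^ 4)⁻¹) * inner ℝ (𝕍.ell i z) (𝕍.form i v)) = 0 := by
    rw [← fderiv_potential hz, hcrit]
    rfl
  -- For `x = |ℓᵢ| > 1` the right side is at least `2(x² - 1 - xM)`, and `2xM ≤ x² + M²`. For `|ℓᵢ|
  -- ≤ 1` it vanishes by the choice of `v`.
  have hterm : ∀ i, (if ‖𝕍.ell i z‖ ≤ 1 then 0 else ‖𝕍.ell i z‖ ^ 2) - (2 + M ^ 2) ≤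
      2 * ((1 - (‖𝕍.ell i z‖ ^ 4)⁻¹) * inner ℝ (𝕍.ell i z) (𝕍.form i v)) := fun i => by
    split_ifs with h
    · rw [hv i (Finset.mem_filter.2 ⟨Finset.mem_univ _, h⟩)]
      rw [inner_zero_right, mul_zero, mul_zero]
      linarith [sq_nonneg M]
    · push Not at h
      set x := ‖𝕍.ell i z‖
      have hx4 : (x ^ 4)⁻¹ ≤ 1 := inv_le_one_of_one_le₀ (one_le_pow₀ h.le)
      have hx4' : 0 ≤ (x ^ 4)⁻¹ := by positivity
      have hx2 : (x ^ 4)⁻¹ * x ^ 2 ≤ 1 := by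
        rw [inv_mul_le_iff₀ (by positivity), mul_one]
        exact pow_le_pow_right₀ h.le (by norm_num)
      have h1 : inner ℝ (𝕍.ell i z) (𝕍.form i v) =
          x ^ 2 + inner ℝ (𝕍.ell i z) (𝕍.form i v - 𝕍.ell i z) := by
        rw [inner_sub_right, real_inner_self_eq_norm_sq]
        ring
      have h2 : -(x * M) ≤ inner ℝ (𝕍.ell i z) (𝕍.form i v - 𝕍.ell i z) := by
        have h3 := (abs_le.1 (abs_real_inner_le_norm (𝕍.ell i z) (𝕍.form i v - 𝕍.ell i z))).1
        have h4 := mul_le_mul_of_nonneg_left (hdisp i) (norm_nonneg (𝕍.ell i z))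
        linarith
      have hxM : 0 ≤ x * M := by positivity
      have h5 : (1 - (x ^ 4)⁻¹) * (x ^ 2 - x * M) ≤
          (1 - (x ^ 4)⁻¹) * inner ℝ (𝕍.ell i z) (𝕍.form i v) := by
        refine mul_le_mul_of_nonneg_left ?_ (by linarith)
        linarith
      have h6 : x ^ 2 - 1 - x * M ≤ (1 - (x ^ 4)⁻¹) * (x ^ 2 - x * M) := by
        nlinarith [mul_nonneg hx4' hxM]
      nlinarith [sq_nonneg (x - M)]
  have htot := Finset.sum_le_sum fun i (_ : i ∈ Finset.univ) => hterm i
  rw [hsum, Finset.sum_sub_distrib, Finset.sum_const, Finset.card_univ, Fintype.card_fin,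
    nsmul_eq_mul, sub_nonpos] at htot
  intro i
  have hn : 0 ≤ n * (2 + M ^ 2) := by positivity
  by_cases h : ‖𝕍.ell i z‖ ≤ 1
  · linarith
  · have h1 := (Finset.single_le_sum
      (f := fun i => if ‖𝕍.ell i z‖ ≤ 1 then 0 else ‖𝕍.ell i z‖ ^ 2)
      (fun i _ => by split_ifs <;> positivity) (Finset.mem_univ i)).trans htot
    simp only [h, if_false] at h1
    nlinarith

/-- Near a point of one of the hyperplanes there are no critical points. -/
lemma eventually_notMem_critSet (hz : z ∉ 𝕍.complement) :
    ∀ᶠ x in 𝓝 z, x ∉ critSet 𝕍.complement 𝕍.potential := by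
  classical
  obtain ⟨i₀, hi₀⟩ : ∃ i, 𝕍.ell i z = 0 := by
    by_contra! h
    exact hz (𝕍.mem_complement.2 h)
  -- With this threshold the `i₀` term of the halved sum for `dφₓ(x - z)` is at most `1 - (n + 2)`.
  -- The others, at most `n` in number, are each at most `1`, so the total is negative.
  have hε : (0 : ℝ) < 1 / (n + 2) := by positivity
  have h0 : ∀ᶠ x in 𝓝 z, ‖𝕍.ell i₀ x‖ ^ 2 < 1 / (n + 2) := by
    refine ((𝕍.continuous_ell i₀).norm.pow 2).continuousAt.eventually_lt continuousAt_const ?_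
    simpa [hi₀] using hε
  have h1 : ∀ᶠ x in 𝓝 z, ∀ i, 𝕍.ell i z = 0 → ‖𝕍.ell i x‖ ^ 2 < 1 := by
    refine eventually_all.2 fun i => ?_
    by_cases hi : 𝕍.ell i z = 0
    · have : ∀ᶠ x in 𝓝 z, ‖𝕍.ell i x‖ ^ 2 < 1 := by
        refine ((𝕍.continuous_ell i).norm.pow 2).continuousAt.eventually_lt continuousAt_const ?_
        simp [hi]
      exact this.mono fun x hx _ => hx
    · exact Eventually.of_forall fun x h => absurd h hi
  have h2 : ∀ᶠ x in 𝓝 z, ∀ i, 𝕍.ell i z ≠ 0 →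
      (1 - (‖𝕍.ell i x‖ ^ 4)⁻¹) * inner ℝ (𝕍.ell i x) (𝕍.form i (x - z)) < 1 := by
    refine eventually_all.2 fun i => ?_
    by_cases hi : 𝕍.ell i z = 0
    · exact Eventually.of_forall fun x h => absurd hi h
    · have hc : ContinuousAt (fun x => (1 - (‖𝕍.ell i x‖ ^ 4)⁻¹) *
          inner ℝ (𝕍.ell i x) (𝕍.form i (x - z))) z := by
        have he : ContinuousAt (𝕍.ell i) z := (𝕍.continuous_ell i).continuousAt
        have hf : ContinuousAt (fun x => 𝕍.form i (x - z)) z := by fun_prop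
        refine (continuousAt_const.sub ((he.norm.pow 4).inv₀ ?_)).mul (ContinuousAt.inner (𝕜 := ℝ) he hf)
        simpa using hi
      have : ∀ᶠ x in 𝓝 z, (1 - (‖𝕍.ell i x‖ ^ 4)⁻¹) *
          inner ℝ (𝕍.ell i x) (𝕍.form i (x - z)) < 1 := by
        refine hc.eventually_lt continuousAt_const ?_
        simp
      exact this.mono fun x hx _ => hx
  filter_upwards [h0, h1, h2] with x hx0 hx1 hx2 hcrit
  have hsum : ∑ i, 2 * ((1 - (‖𝕍.ell i x‖ ^ 4)⁻¹) *
      inner ℝ (𝕍.ell i x) (𝕍.form i (x - z))) = 0 := by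
    rw [← fderiv_potential hcrit.1, hcrit.2]
    rfl
  have hne := 𝕍.mem_complement.1 hcrit.1
  have hself : ∀ i, 𝕍.ell i z = 0 → (1 - (‖𝕍.ell i x‖ ^ 4)⁻¹) *
      inner ℝ (𝕍.ell i x) (𝕍.form i (x - z)) = ‖𝕍.ell i x‖ ^ 2 - (‖𝕍.ell i x‖ ^ 2)⁻¹ :=
    fun i hi => by
      have hp : ‖𝕍.ell i x‖ ≠ 0 := norm_ne_zero_iff.2 (hne i)
      rw [← ell_sub, hi, sub_zero, real_inner_self_eq_norm_sq]
      field_simp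
  have hle : ∀ i, (1 - (‖𝕍.ell i x‖ ^ 4)⁻¹) *
      inner ℝ (𝕍.ell i x) (𝕍.form i (x - z)) ≤ 1 := fun i => by
    by_cases hi : 𝕍.ell i z = 0
    · rw [hself i hi]
      have : 0 ≤ (‖𝕍.ell i x‖ ^ 2)⁻¹ := by positivity
      linarith [hx1 i hi]
    · exact (hx2 i hi).le
  have hi₀le : (1 - (‖𝕍.ell i₀ x‖ ^ 4)⁻¹) *
      inner ℝ (𝕍.ell i₀ x) (𝕍.form i₀ (x - z)) ≤ 1 - (n + 2) := by
    rw [hself i₀ hi₀]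
    have hp : 0 < ‖𝕍.ell i₀ x‖ ^ 2 := by
      have := hne i₀
      positivity
    have : (n + 2 : ℝ) ≤ (‖𝕍.ell i₀ x‖ ^ 2)⁻¹ := by
      rw [le_inv_comm₀ (by positivity) hp, ← one_div]
      exact hx0.le
    linarith [hx1 i₀ hi₀]
  rw [← Finset.mul_sum, mul_eq_zero, or_iff_right two_ne_zero,
    ← Finset.add_sum_erase _ _ (Finset.mem_univ i₀)] at hsum
  have hrest := Finset.sum_le_card_nsmul (Finset.univ.erase i₀) _ 1 fun i _ => hle i
  have hcard : ((Finset.univ.erase i₀ : Finset (Fin n)).card : ℝ) ≤ n := by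
    have := Finset.card_le_univ (Finset.univ.erase i₀ : Finset (Fin n))
    rw [Fintype.card_fin] at this
    exact_mod_cast this
  rw [nsmul_eq_mul, mul_one] at hrest
  linarith

/-- The critical points of the potential lie in a compact subset of the complement. -/
lemma exists_isCompact_critSet : ∃ K : Set (Fin d → ℂ), IsCompact K ∧ K ⊆ 𝕍.complement ∧
    critSet 𝕍.complement 𝕍.potential ⊆ K := by
  obtain ⟨R, hR⟩ := 𝕍.exists_critSet_bound
  refine ⟨closure (critSet 𝕍.complement 𝕍.potential), ?_, fun z hz => ?_, subset_closure⟩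
  · refine Metric.isCompact_of_isClosed_isBounded isClosed_closure (Bornology.IsBounded.closure ?_)
    exact (Metric.isBounded_closedBall (x := (0 : Fin d → ℂ)) (r := R)).subset fun z hz =>
      mem_closedBall_zero_iff.2 (hR z hz)
  · by_contra h
    exact (mem_closure_iff_frequently.1 hz) (𝕍.eventually_notMem_critSet h)

lemma isPreWeinsteinManifold_potential :
    IsPreWeinsteinManifold 𝕍.complement 𝕍.omega
      (kahlerGradient 𝕍.omega 𝕍.potential) 𝕍.potential := by
  obtain ⟨K, hK, hKU, hcrit⟩ := 𝕍.exists_isCompact_critSet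
  exact 𝕍.isStrictlyPSHOn_potential.isPreWeinsteinManifold (fun z hz => omega_eq hz)
    𝕍.isExhaustingOn_potential hK hKU hcrit (C := 0)
    fun z hz => by simpa using fderiv_potential_grad_le hz

end HyperplaneArrangement

/-! ### Morse functions, regular values and cutoffs. -/

section Morse

variable {E : Type*} [NormedAddCommGroup E] [NormedSpace ℝ E]

/-- A Morse function whose critical points lie in a compact set has finitely many of them. -/
lemma IsMorseOn.finite_critSet [FiniteDimensional ℝ E] {U : Set E} (hU : IsOpen U) {ψ : E → ℝ}
    (hψ : ContDiffOn ℝ ∞ ψ U) (hM : IsMorseOn U ψ) {K : Set E} (hK : IsCompact K) (hKU : K ⊆ U)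
    (hcrit : critSet U ψ ⊆ K) : (critSet U ψ).Finite := by
  by_contra hinf
  obtain ⟨x, hxK, hx⟩ := Set.Infinite.exists_accPt_of_subset_isCompact hinf hK hcrit
  rw [accPt_iff_frequently_nhdsNE] at hx
  have hd : DifferentiableAt ℝ (fderiv ℝ ψ) x :=
    (hψ.contDiffAt (hU.mem_nhds (hKU hxK))).differentiableAt_fderiv
  have hx0 : fderiv ℝ ψ x = 0 := by
    by_contra h
    have hev : ∀ᶠ y in 𝓝[≠] x, y ∉ critSet U ψ := by
      filter_upwards [nhdsWithin_le_nhds (hd.continuousAt.eventually_ne h)] with y hy hy'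
      exact hy hy'.2
    exact hx hev
  have hker : LinearMap.ker (fderiv ℝ (fderiv ℝ ψ) x : E →ₗ[ℝ] E →L[ℝ] ℝ) = ⊥ := by
    refine LinearMap.ker_eq_bot'.2 fun u hu => hM x ⟨hKU hxK, hx0⟩ u fun v => ?_
    have hu' : fderiv ℝ (fderiv ℝ ψ) x u = 0 := hu
    rw [hu']
    rfl
  -- An accumulation point of critical points is critical, but an injective Hessian bounds `dψ`
  -- below to first order and so isolates the zero.
  obtain ⟨C, -, hC⟩ := LinearMap.exists_antilipschitzWith _ hker
  have hev : ∀ᶠ y in 𝓝[≠] x, y ∉ critSet U ψ := by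
    filter_upwards [hd.hasFDerivAt.eventually_ne (c := 0) ⟨C, hC⟩] with y hy hy'
    exact hy hy'.2
  exact hx hev

/-- A consequence of Sard's theorem: small regular values of a map between spaces of the same
dimension. -/
lemma exists_small_regular_value [FiniteDimensional ℝ E] {F : Type*} [NormedAddCommGroup F]
    [NormedSpace ℝ F] [FiniteDimensional ℝ F] (hfin : Module.finrank ℝ F = Module.finrank ℝ E)
    {U : Set E} {f : E → F} (hf : ∀ z ∈ U, DifferentiableAt ℝ f z) {η : ℝ} (hη : 0 < η) :
    ∃ l : F, ‖l‖ < η ∧ ∀ z ∈ U, f z = l → Function.Injective (fderiv ℝ f z) := by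
  let e : F ≃L[ℝ] E := ContinuousLinearEquiv.ofFinrankEq hfin
  let _ : MeasurableSpace E := borel E
  have : BorelSpace E := ⟨rfl⟩
  -- In equal dimensions Sard's theorem requires only differentiability: the image of the degenerate
  -- points is Haar-null, hence misses some point of any nonempty open set.
  set s : Set E := {z | z ∈ U ∧ ((e : F →L[ℝ] E) ∘L fderiv ℝ f z).det = 0}
  have hnull : (MeasureTheory.Measure.addHaar : MeasureTheory.Measure E) ((e ∘ f) '' s) = 0 :=
    MeasureTheory.addHaar_image_eq_zero_of_det_fderivWithin_eq_zero _
      (f' := fun z => (e : F →L[ℝ] E) ∘L fderiv ℝ f z)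
      (fun z hz => (e.hasFDerivAt.comp z (hf z hz.1).hasFDerivAt).hasFDerivWithinAt)
      fun z hz => hz.2
  set B : Set E := {y | ‖e.symm y‖ < η}
  have hB : IsOpen B := isOpen_lt e.symm.continuous.norm continuous_const
  obtain ⟨y, hyB, hy⟩ : ∃ y ∈ B, y ∉ (e ∘ f) '' s := by
    by_contra! h
    exact (hB.measure_pos MeasureTheory.Measure.addHaar
      ⟨0, by simpa [B] using hη⟩).ne' (MeasureTheory.measure_mono_null h hnull)
  refine ⟨e.symm y, hyB, fun z hz hfz => ?_⟩
  have hdet : ((e : F →L[ℝ] E) ∘L fderiv ℝ f z).det ≠ 0 := fun h =>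
    hy ⟨z, ⟨hz, h⟩, by simp [hfz]⟩
  have hbij := LinearMap.equivOfDetNeZero _ hdet |>.injective
  intro u v huv
  refine hbij ?_
  change e (fderiv ℝ f z u) = e (fderiv ℝ f z v)
  rw [huv]

/-- A smooth compactly supported map that agrees with the identity near a given compact set. -/
lemma exists_compactly_supported_id [FiniteDimensional ℝ E] {K U : Set E} (hK : IsCompact K)
    (hU : IsOpen U) (hKU : K ⊆ U) :
    ∃ (f : E → E) (L N : Set E), ContDiff ℝ ∞ f ∧ IsCompact L ∧ L ⊆ U ∧ IsOpen N ∧ K ⊆ N ∧ N ⊆ L ∧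
      (∀ z ∉ L, f z = 0) ∧ ∀ z ∈ N, f z = z := by
  have := FiniteDimensional.proper_real E
  obtain ⟨L, hL, hKL, hLU⟩ := exists_compact_between hK hU hKU
  obtain ⟨χ, hχ1, hχ0, -⟩ := exists_contMDiffMap_one_nhds_of_subset_interior
    (modelWithCornersSelf ℝ E) (n := (⊤ : ℕ∞)) hK.isClosed hKL
  obtain ⟨N, hN, hKN, hN1⟩ := eventually_nhdsSet_iff_exists.1 hχ1
  refine ⟨fun z => χ z • z, L, N, χ.contMDiff.contDiff.smul contDiff_id, hL, hLU, hN, hKN,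
    fun z hz => ?_, fun z hz => ?_, fun z hz => ?_⟩
  · by_contra h
    exact zero_ne_one ((hχ0 z h).symm.trans (hN1 z hz))
  · simp [hχ0 z hz]
  · simp [hN1 z hz]

lemma ContDiff.fderiv_clm_comp {F : Type*} [NormedAddCommGroup F] [NormedSpace ℝ F] {f : E → F}
    (hf : ContDiff ℝ ∞ f) (l : F →L[ℝ] ℝ) (z : E) :
    fderiv ℝ (fun x => l (f x)) z = l ∘L fderiv ℝ f z :=
  (l.hasFDerivAt.comp z ((hf.differentiable (by simp)) z).hasFDerivAt).fderiv

lemma ContDiff.fderiv_fderiv_clm_comp {F : Type*} [NormedAddCommGroup F] [NormedSpace ℝ F] {f : E → F}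
    (hf : ContDiff ℝ ∞ f) (l : F →L[ℝ] ℝ) (z u v : E) :
    fderiv ℝ (fderiv ℝ fun x => l (f x)) z u v = l (fderiv ℝ (fderiv ℝ f) z u v) := by
  have h : fderiv ℝ (fun x => l (f x)) = fun x => (ContinuousLinearMap.compL ℝ E F ℝ l)
      (fderiv ℝ f x) := funext fun x => hf.fderiv_clm_comp l x
  have hd : DifferentiableAt ℝ (fderiv ℝ f) z := hf.contDiffAt.differentiableAt_fderiv
  have h' : HasFDerivAt (fun x => (ContinuousLinearMap.compL ℝ E F ℝ l) (fderiv ℝ f x)) _ z :=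
    (ContinuousLinearMap.compL ℝ E F ℝ l).hasFDerivAt.comp z hd.hasFDerivAt
  rw [h, h'.fderiv]
  rfl

end Morse

/-! ### Compactly supported perturbations to Morse functions. -/

section Perturbation

variable {E : Type*} [NormedAddCommGroup E] [NormedSpace ℂ E]
  [NormedSpace ℝ E] [IsScalarTower ℝ ℂ E] [FiniteDimensional ℝ E]

/-- Positivity is uniform on the compact product of `L` with the unit sphere and extends by
homogeneity. The constant measures how large a perturbation may be. -/
lemma IsStrictlyPSHOn.exists_leviForm_lower_bound {U : Set E} {ψ : E → ℝ}
    (H : IsStrictlyPSHOn U ψ) {L : Set E} (hL : IsCompact L) (hLU : L ⊆ U) :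
    ∃ c : ℝ, 0 < c ∧ ∀ z ∈ L, ∀ u, c * ‖u‖ ^ 2 ≤ leviForm ψ z u u := by
  have := FiniteDimensional.proper_real E
  have hc : ContinuousOn (leviForm ψ) L :=
    ((contDiffOn_leviForm H.isOpen H.smooth).continuousOn).mono hLU
  have hc2 : ContinuousOn (fun p : E × E => leviForm ψ p.1 p.2 p.2) (L ×ˢ Metric.sphere 0 1) :=
    ((hc.comp continuousOn_fst fun p hp => hp.1).clm_apply continuousOn_snd).clm_apply
      continuousOn_snd
  obtain ⟨c, hc0, hcb⟩ := (hL.prod (isCompact_sphere (0 : E) 1)).exists_forall_le' hc2 (a := 0)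
    fun p hp => H.pos p.1 (hLU hp.1) p.2 (ne_zero_of_mem_unit_sphere ⟨p.2, hp.2⟩)
  refine ⟨c, hc0, fun z hz u => ?_⟩
  by_cases hu : u = 0
  · simp [hu]
  have hn : ‖u‖ ≠ 0 := norm_ne_zero_iff.2 hu
  have h1 := hcb (z, ‖u‖⁻¹ • u) ⟨hz, by simp [norm_smul, hn]⟩
  simp only [map_smul, smul_apply, smul_eq_mul] at h1
  have h2 := mul_le_mul_of_nonneg_right h1 (sq_nonneg ‖u‖)
  refine h2.trans_eq ?_
  field_simp

/-- A compactly supported perturbation that preserves strict plurisubharmonicity yields a structure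
of the same kind. -/
lemma IsStrictlyPSHOn.isPreWeinsteinManifold_add {U : Set E} {ψ : E → ℝ} (H : IsStrictlyPSHOn U ψ)
    (hex : IsExhaustingOn U ψ) (hnn : ∀ z ∈ U, 0 ≤ ψ z)
    (hgrowth : ∀ z ∈ U, fderiv ℝ ψ z (leviGrad ψ z) ≤ ψ z) {L : Set E} (hL : IsCompact L)
    (hLU : L ⊆ U) (hcrit : critSet U ψ ⊆ L) {h : E → ℝ} (hh : ContDiff ℝ ∞ h)
    (hsupp : ∀ z ∉ L, h z = 0)
    (hpos : ∀ z ∈ L, ∀ u, u ≠ 0 → 0 < leviForm ψ z u u + leviForm h z u u) :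
    critSet U (fun z => ψ z + h z) ⊆ L ∧
    IsPreWeinsteinManifold U (negDDC fun z => ψ z + h z)
      (kahlerGradient (negDDC fun z => ψ z + h z) fun z => ψ z + h z) fun z => ψ z + h z := by
  have hloc : ∀ z ∉ L, (fun z => ψ z + h z) =ᶠ[𝓝 z] ψ := fun z hz => by
    filter_upwards [hL.isClosed.isOpen_compl.mem_nhds hz] with x hx
    rw [hsupp x hx, add_zero]
  have hcs : HasCompactSupport h := HasCompactSupport.intro hL hsupp
  obtain ⟨B, hB⟩ := hcs.exists_bound_of_continuous hh.continuous
  have hB' : ∀ z, -B ≤ h z := fun z => (abs_le.1 (hB z)).1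
  have Hh : IsStrictlyPSHOn U fun z => ψ z + h z := by
    refine ⟨H.isOpen, H.smooth.add hh.contDiffOn, fun z hz u hu => ?_⟩
    by_cases hzL : z ∈ L
    · rw [leviForm_add (H.contDiffAt hz) hh.contDiffAt]
      exact hpos z hzL u hu
    · rw [leviForm_congr (hloc z hzL)]
      exact H.pos z hz u hu
  have hcrit' : critSet U (fun z => ψ z + h z) ⊆ L := fun z hz => by
    by_contra hzL
    refine hzL (hcrit ⟨hz.1, ?_⟩)
    rw [← (hloc z hzL).fderiv_eq]
    exact hz.2
  refine ⟨hcrit', ?_⟩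
  have hex' : IsExhaustingOn U fun z => ψ z + h z := fun c => by
    have hS := hex (c + B)
    have heq : {z | z ∈ U ∧ ψ z + h z ≤ c} =
        {z | z ∈ U ∧ ψ z ≤ c + B} ∩ (fun z => ψ z + h z) ⁻¹' Iic c := by
      ext z
      simp only [mem_inter_iff, mem_ofPred_eq, mem_preimage, mem_Iic]
      have := hB' z
      constructor
      · rintro ⟨h1, h2⟩
        exact ⟨⟨h1, by linarith⟩, h2⟩
      · rintro ⟨⟨h1, -⟩, h2⟩
        exact ⟨h1, h2⟩
    rw [heq]
    refine hS.of_isClosed_subset ?_ inter_subset_left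
    exact ContinuousOn.preimage_isClosed_of_isClosed
      (Hh.smooth.continuousOn.mono fun z hz => hz.1) hS.isClosed isClosed_Iic
  have hcont : ContinuousOn (fun z => fderiv ℝ (fun z => ψ z + h z) z
      (leviGrad (fun z => ψ z + h z) z)) L :=
    ((ContDiffOn.fderiv_infty H.isOpen Hh.smooth).continuousOn.clm_apply
      Hh.contDiffOn_grad.continuousOn).mono hLU
  obtain ⟨C, hC⟩ := hL.bddAbove_image hcont
  -- On `L` the derivative along the gradient is at most `C` while `ψ + h ≥ -B`; off `L` the old
  -- growth bound holds unchanged.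
  refine Hh.isPreWeinsteinManifold (fun _ _ => rfl) hex' hL hLU hcrit' (C := |C| + |B|)
    fun z hz => ?_
  by_cases hzL : z ∈ L
  · have h1 := hC (mem_image_of_mem _ hzL)
    have h2 := hB' z
    have h3 := hnn z hz
    linarith [le_abs_self C, le_abs_self B]
  · have h1 : leviGrad (fun z => ψ z + h z) z = leviGrad ψ z := by
      rw [leviGrad, leviGrad, leviForm_congr (hloc z hzL), (hloc z hzL).fderiv_eq]
    rw [(hloc z hzL).fderiv_eq, h1, hsupp z hzL]
    have := hgrowth z hz
    linarith [abs_nonneg C, abs_nonneg B]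

/-- A strictly plurisubharmonic exhausting function becomes Morse after an arbitrarily small
compactly supported perturbation, through structures of the same kind. -/
theorem IsStrictlyPSHOn.exists_morse_perturbation {U : Set E} {ψ : E → ℝ}
    (H : IsStrictlyPSHOn U ψ) (hex : IsExhaustingOn U ψ) (hnn : ∀ z ∈ U, 0 ≤ ψ z)
    (hgrowth : ∀ z ∈ U, fderiv ℝ ψ z (leviGrad ψ z) ≤ ψ z) {K : Set E} (hK : IsCompact K)
    (hKU : K ⊆ U) (hcrit : critSet U ψ ⊆ K) (m : ℕ) {ε : ℝ} (hε : 0 < ε) :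
    ∃ h : E → ℝ, ContDiff ℝ ∞ h ∧ HasCompactSupport h ∧ tsupport h ⊆ U ∧
      (∀ k ≤ m, ∀ z, ‖iteratedFDeriv ℝ k h z‖ < ε) ∧
      (∃ L : Set E, IsCompact L ∧ L ⊆ U ∧ ∀ t ∈ Icc (0 : ℝ) 1,
        critSet U (fun z => ψ z + t * h z) ⊆ L ∧
        IsPreWeinsteinManifold U (negDDC fun z => ψ z + t * h z)
          (kahlerGradient (negDDC fun z => ψ z + t * h z) fun z => ψ z + t * h z)
          fun z => ψ z + t * h z) ∧
      IsWeinsteinManifold U (negDDC fun z => ψ z + h z)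
        (kahlerGradient (negDDC fun z => ψ z + h z) fun z => ψ z + h z) (fun z => ψ z + h z) ∧
      (critSet U fun z => ψ z + h z).Finite := by
  obtain ⟨f, L, N, hf, hL, hLU, hN, hKN, hNL, hf0, hf1⟩ :=
    exists_compactly_supported_id hK H.isOpen hKU
  have hfs : HasCompactSupport f := HasCompactSupport.intro hL hf0
  -- bounds for the derivatives of the cutoff map
  obtain ⟨B, hB0, hBit, hB1, hB2⟩ : ∃ B : ℝ, 0 < B ∧ (∀ k ≤ m, ∀ z, ‖iteratedFDeriv ℝ k f z‖ ≤ B) ∧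
      (∀ z, ‖fderiv ℝ f z‖ ≤ B) ∧ ∀ z, ‖fderiv ℝ (fderiv ℝ f) z‖ ≤ B := by
    have hk : ∀ k : ℕ, ∃ b, ∀ z, ‖iteratedFDeriv ℝ k f z‖ ≤ b := fun k =>
      (hfs.iteratedFDeriv (𝕜 := ℝ) k).exists_bound_of_continuous
        (hf.continuous_iteratedFDeriv (by exact_mod_cast le_top))
    choose b hb using hk
    have hf' : ContDiff ℝ ∞ (fderiv ℝ f) := hf.fderiv_right (by simp)
    obtain ⟨b₁, hb₁⟩ := (hfs.fderiv ℝ).exists_bound_of_continuous hf'.continuous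
    obtain ⟨b₂, hb₂⟩ := ((hfs.fderiv ℝ).fderiv ℝ).exists_bound_of_continuous
      (hf'.continuous_fderiv (by simp))
    refine ⟨1 + |b₁| + |b₂| + ∑ k ∈ Finset.range (m + 1), |b k|, by positivity,
      fun k hkm z => ?_, fun z => ?_, fun z => ?_⟩
    · have h1 := Finset.single_le_sum (f := fun k => |b k|) (fun _ _ => abs_nonneg _)
        (Finset.mem_range.2 (Nat.lt_succ_of_le hkm))
      linarith [hb k z, le_abs_self (b k), abs_nonneg b₁, abs_nonneg b₂]
    all_goals
      have h1 : 0 ≤ ∑ k ∈ Finset.range (m + 1), |b k| := Finset.sum_nonneg fun _ _ => abs_nonneg _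
      linarith [hb₁ z, hb₂ z, le_abs_self b₁, le_abs_self b₂, abs_nonneg b₁, abs_nonneg b₂]
  obtain ⟨c, hc, hcL⟩ := H.exists_leviForm_lower_bound hL hLU
  have hcontd : ContinuousOn (fderiv ℝ ψ) U :=
    (ContDiffOn.fderiv_infty H.isOpen H.smooth).continuousOn
  obtain ⟨c', hc', hcL'⟩ : ∃ c', 0 < c' ∧ ∀ z ∈ L \ N, c' ≤ ‖fderiv ℝ ψ z‖ := by
    refine (hL.diff hN).exists_forall_le' (a := 0)
      (hcontd.norm.mono (sdiff_subset.trans hLU)) fun z hz => ?_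
    exact norm_pos_iff.2 fun h => hz.2 (hKN (hcrit ⟨hLU hz.1, h⟩))
  -- The three bounds on `‖l‖ B` serve, in order, to make the derivatives of `h` small, to exclude
  -- critical points on `L \ N`, and to keep the Levi form positive (`c / 4` for each of its two
  -- Hessian terms).
  set η : ℝ := min ε (min c' (c / 4)) / B with hη
  have hη0 : 0 < η := by positivity
  have hfin : Module.finrank ℝ (E →L[ℝ] ℝ) = Module.finrank ℝ E := by
    rw [← (LinearMap.toContinuousLinearMap (𝕜 := ℝ) (E := E) (F' := ℝ)).finrank_eq]
    exact Subspace.dual_finrank_eq (K := ℝ) (V := E)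
  obtain ⟨l', hl', hreg⟩ := exists_small_regular_value hfin (f := fderiv ℝ ψ)
    (fun z hz => (H.contDiffAt hz).differentiableAt_fderiv) hη0
  set l : E →L[ℝ] ℝ := -l' with hl
  have hlB : ‖l‖ * B < min ε (min c' (c / 4)) := by
    rw [hl, norm_neg]
    exact (lt_div_iff₀ hB0).1 hl'
  have hlε : ‖l‖ * B < ε := hlB.trans_le (min_le_left _ _)
  have hlc' : ‖l‖ * B < c' := hlB.trans_le ((min_le_right _ _).trans (min_le_left _ _))
  have hlc : ‖l‖ * B < c / 4 := hlB.trans_le ((min_le_right _ _).trans (min_le_right _ _))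
  -- On `N` this is the linear form `l = -l'`, so critical points of `ψ + h` there are solutions of
  -- `dψ = l'`, a regular value of `dψ`.
  set h : E → ℝ := fun z => l (f z) with hh
  have hsm : ContDiff ℝ ∞ h := l.contDiff.comp hf
  have hh0 : ∀ z ∉ L, h z = 0 := fun z hz => by simp [hh, hf0 z hz]
  have hlevi : ∀ z u, |leviForm h z u u| ≤ c / 2 * ‖u‖ ^ 2 := fun z u => by
    have hb : ∀ w : E, |fderiv ℝ (fderiv ℝ h) z w w| ≤ c / 4 * ‖w‖ ^ 2 := fun w => by
      rw [hh, hf.fderiv_fderiv_clm_comp]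
      calc |l (fderiv ℝ (fderiv ℝ f) z w w)| ≤ ‖l‖ * ‖fderiv ℝ (fderiv ℝ f) z w w‖ := l.le_opNorm _
        _ ≤ ‖l‖ * (‖fderiv ℝ (fderiv ℝ f) z‖ * ‖w‖ * ‖w‖) := by
          gcongr
          exact ContinuousLinearMap.le_opNorm₂ _ _ _
        _ ≤ ‖l‖ * (B * ‖w‖ * ‖w‖) := by
          gcongr
          exact hB2 z
        _ = (‖l‖ * B) * ‖w‖ ^ 2 := by ring
        _ ≤ c / 4 * ‖w‖ ^ 2 := by gcongr
    have h1 := hb u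
    have h2 := hb (Complex.I • u)
    rw [norm_smul, Complex.norm_I, one_mul] at h2
    rw [leviForm_apply]
    refine (abs_add_le _ _).trans ?_
    linarith
  have hpre : ∀ t ∈ Icc (0 : ℝ) 1, critSet U (fun z => ψ z + t * h z) ⊆ L ∧
      IsPreWeinsteinManifold U (negDDC fun z => ψ z + t * h z)
        (kahlerGradient (negDDC fun z => ψ z + t * h z) fun z => ψ z + t * h z)
        fun z => ψ z + t * h z := fun t ht => by
    refine H.isPreWeinsteinManifold_add hex hnn hgrowth hL hLU (hcrit.trans (hKN.trans hNL))
      (h := fun z => t * h z) (contDiff_const.mul hsm) (fun z hz => by simp [hh0 z hz])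
      fun z hz u hu => ?_
    have h1 : leviForm (fun z => t * h z) z u u = t * leviForm h z u u := by
      have h2 : (fun z => t * h z) = fun z => (t • l) (f z) := rfl
      have h3 : ∀ w, fderiv ℝ (fderiv ℝ fun z => t * h z) z w w =
          t * fderiv ℝ (fderiv ℝ h) z w w := fun w => by
        rw [h2, hf.fderiv_fderiv_clm_comp, hh, hf.fderiv_fderiv_clm_comp]
        rfl
      rw [leviForm_apply, leviForm_apply, h3, h3]
      ring
    have h3 : |t * leviForm h z u u| ≤ c / 2 * ‖u‖ ^ 2 := by
      rw [abs_mul, abs_of_nonneg ht.1]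
      exact (mul_le_of_le_one_left (abs_nonneg _) ht.2).trans (hlevi z u)
    have h4 := hcL z hz u
    have h5 : 0 < c * ‖u‖ ^ 2 := by positivity
    rw [h1]
    linarith [(abs_le.1 h3).1]
  obtain ⟨hcrit1, hpre1⟩ := hpre 1 ⟨zero_le_one, le_rfl⟩
  simp only [one_mul] at hcrit1 hpre1
  have hmorse : IsMorseOn U fun z => ψ z + h z := by
    rintro z hz
    have hdz : fderiv ℝ ψ z + fderiv ℝ h z = 0 := by
      rw [← fderiv_fun_add ((H.contDiffAt hz.1).differentiableAt (by simp))
        (hsm.contDiffAt.differentiableAt (by simp))]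
      exact hz.2
    have hzN : z ∈ N := by
      by_contra hzN
      have h1 := hcL' z ⟨hcrit1 hz, hzN⟩
      rw [eq_neg_of_add_eq_zero_left hdz, norm_neg, hh, hf.fderiv_clm_comp] at h1
      have h2 : ‖l ∘L fderiv ℝ f z‖ ≤ ‖l‖ * B :=
        (l.opNorm_comp_le _).trans (by gcongr; exact hB1 z)
      linarith
    have hloc : h =ᶠ[𝓝 z] l := by
      filter_upwards [hN.mem_nhds hzN] with x hx
      simp only [hh]
      rw [hf1 x hx]
    have hval : fderiv ℝ ψ z = l' := by
      rw [eq_neg_of_add_eq_zero_left hdz, hloc.fderiv_eq, l.fderiv, hl, neg_neg]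
    have hinj := hreg z hz.1 hval
    -- Linearity of `h` near `z` leaves the Hessian of `ψ` unchanged, and that Hessian is the
    -- derivative of `dψ`, injective over `l'`.
    have hsec : fderiv ℝ (fderiv ℝ fun z => ψ z + h z) z = fderiv ℝ (fderiv ℝ ψ) z := by
      have hcst : fderiv ℝ (l : E → ℝ) = fun _ => l := funext fun x => l.fderiv
      rw [fderiv_fderiv_add (H.contDiffAt hz.1) hsm.contDiffAt, hloc.fderiv.fderiv_eq, hcst]
      simp
    intro u hu
    rw [hsec] at hu
    exact hinj ((ContinuousLinearMap.ext hu).trans (map_zero _).symm)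
  refine ⟨h, hsm, HasCompactSupport.intro hL hh0, ?_, fun k hk z => ?_, ⟨L, hL, hLU, hpre⟩,
    ⟨hpre1, hmorse⟩, hmorse.finite_critSet H.isOpen hpre1.smooth_fun hL hLU hcrit1⟩
  · refine (closure_minimal (fun z hz => ?_) hL.isClosed).trans hLU
    by_contra hzL
    exact hz (hh0 z hzL)
  · refine lt_of_le_of_lt ?_ hlε
    refine (l.norm_iteratedFDeriv_comp_left (N := ∞) hf.contDiffAt
      (by exact_mod_cast le_top)).trans ?_
    gcongr
    exact hBit k hk z

end Perturbation

theorem mainTheorem7 {d n : ℕ} (𝕍 : HyperplaneArrangement d n) :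
    -- the critical points of `φ` lie in a compact subset of `M(𝕍)`
    (∃ K : Set (Fin d → ℂ), IsCompact K ∧ K ⊆ 𝕍.complement ∧
      critSet 𝕍.complement 𝕍.potential ⊆ K) ∧
    -- `φ` is a potential for `ω`
    (∀ z ∈ 𝕍.complement, 𝕍.omega z = negDDC 𝕍.potential z) ∧
    -- `(M(𝕍), ω, ∇φ)` is Liouville and `φ` is an exhausting Lyapunov function for `∇φ`
    IsPreWeinsteinManifold 𝕍.complement 𝕍.omega
      (kahlerGradient 𝕍.omega 𝕍.potential) 𝕍.potential ∧
    -- hence a Weinstein manifold with finitely many critical points whenever `φ` is Morse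
    (IsMorseOn 𝕍.complement 𝕍.potential →
      IsWeinsteinManifold 𝕍.complement 𝕍.omega
        (kahlerGradient 𝕍.omega 𝕍.potential) 𝕍.potential ∧
      (critSet 𝕍.complement 𝕍.potential).Finite) ∧
    -- in general, `φ` becomes Morse after an arbitrarily small compactly supported perturbation,
    -- through structures of the same kind with critical points in one compact set
    (∀ (m : ℕ) (ε : ℝ), 0 < ε → ∃ h : (Fin d → ℂ) → ℝ,
      ContDiff ℝ ∞ h ∧ HasCompactSupport h ∧ tsupport h ⊆ 𝕍.complement ∧
      (∀ k ≤ m, ∀ z, ‖iteratedFDeriv ℝ k h z‖ < ε) ∧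
      (∃ K : Set (Fin d → ℂ), IsCompact K ∧ K ⊆ 𝕍.complement ∧
        ∀ t ∈ Set.Icc (0 : ℝ) 1,
          critSet 𝕍.complement (fun z => 𝕍.potential z + t * h z) ⊆ K ∧
          IsPreWeinsteinManifold 𝕍.complement
            (negDDC fun z => 𝕍.potential z + t * h z)
            (kahlerGradient (negDDC fun z => 𝕍.potential z + t * h z)
              (fun z => 𝕍.potential z + t * h z))
            (fun z => 𝕍.potential z + t * h z)) ∧
      IsWeinsteinManifold 𝕍.complement
        (negDDC fun z => 𝕍.potential z + h z)
        (kahlerGradient (negDDC fun z => 𝕍.potential z + h z)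
          (fun z => 𝕍.potential z + h z))
        (fun z => 𝕍.potential z + h z) ∧
      (critSet 𝕍.complement fun z => 𝕍.potential z + h z).Finite) := by
  obtain ⟨K, hK, hKU, hcrit⟩ := 𝕍.exists_isCompact_critSet
  have hpre := 𝕍.isPreWeinsteinManifold_potential
  exact ⟨⟨K, hK, hKU, hcrit⟩, fun z hz => HyperplaneArrangement.omega_eq hz, hpre,
    fun hM => ⟨⟨hpre, hM⟩,
      hM.finite_critSet 𝕍.isOpen_complement hpre.smooth_fun hK hKU hcrit⟩,
    fun m ε hε => 𝕍.isStrictlyPSHOn_potential.exists_morse_perturbation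
      𝕍.isExhaustingOn_potential (fun z _ => 𝕍.potential_nonneg z)
      (fun z hz => HyperplaneArrangement.fderiv_potential_grad_le hz) hK hKU hcrit m hε⟩
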